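/- Let $K_n=(K_{1,n},K_{2,n})^T=L^n(-q,r)^T$, $n\ge 0$, be the isospectral AKNS hierarchy, where $$L=\begin{pmatrix}-\partial_x+2q\partial_x^{-1}r & 2q\partial_x^{-1}q\\ -2r\partial_x^{-1}r & \partial_x-2r\partial_x^{-1}q\end{pmatrix}$$ acts on columns $(u_1,u_2)^T$ of differential polynomials in $q,r$, and $\partial_x^{-1}$ (applied to $ru_1+qu_2$) is the formal antiderivative of a differential polynomial, with no constant term. Let $\delta,\sigma_1,\sigma_2\in\{1,-1\}$ with $\sigma_1\sigma_2=1$. The independent variables are the real variables $t=(t_1,t_3,t_5,\dots)$ with $t_1=x$; write $(\sigma_1x,\sigma_2t)$ for the point with $x$ replaced by $\sigma_1x$ and every $t_{2j+1}$, $j\ge1$, by $\sigma_2t_{2j+1}$; $^*$ denotes (entrywise) complex conjugation. The local and nonlocal complex mKdV hierarchy is $$q_{t_{2l+1}}=K_{1,2l+1}\big|_{r(x,t)=\delta q^*(\sigma_1x,\sigma_2t)},\qquad l=0,1,2,\dots$$ Let $n\ge0$, $A,T\in\mathbb C^{2(n+1)\times2(n+1)}$, $C^\pm\in\mathbb C^{2(n+1)}$,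 and $$\varphi=\exp\Bigl(\tfrac12\sum_{j\ge0}A^{2j+1}t_{2j+1}\Bigr)C^+,\qquad \psi=\exp\Bigl(-\tfrac12\sum_{j\ge0}A^{2j+1}t_{2j+1}\Bigr)C^-,$$ considered at the points $t$ at which the series converges. Let $|\widehat\varphi^{(a)};\widehat\psi^{(b)}|$ be the determinant with columns $\varphi,\partial_x\varphi,\dots,\partial_x^a\varphi,\psi,\partial_x\psi,\dots,\partial_x^b\psi$ (no columns from $\varphi$ if $a=-1$). (1) Suppose $AT+\sigma_1TA^*=0$, $TT^*=\delta\sigma_1I$ and $C^-=TC^{+*}$. Then $\psi(x,t)=T\varphi^*(\sigma_1x,\sigma_2t)$, and at every point $(x,t)$ where $|\widehat\varphi^{(n)};\widehat\psi^{(n)}|\ne0$ this determinant is also nonzero at $(\sigma_1x,\sigma_2t)$ and $$q=\frac{2|\widehat\varphi^{(n-1)};\widehat\psi^{(n+1)}|}{|\widehat\varphi^{(n)};\widehat\psi^{(n)}|}$$ solves every equation of the complex mKdV hierarchy ($q$ and $r=\delta q^*(\sigma_1x,\sigma_2t)$ being smooth in $x$ near the point, and $q$ differentiable in $t_{2l+1}$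 at it). (2) For every $\mathbf K\in\mathbb C^{(n+1)\times(n+1)}$ the matrices $$T=\begin{pmatrix}0&\delta\sigma_1 I\\ I&0\end{pmatrix},\qquad A=\begin{pmatrix}\mathbf K&0\\0&-\sigma_1\mathbf K^*\end{pmatrix}$$ satisfy $AT+\sigma_1TA^*=0$ and $TT^*=\delta\sigma_1I$. (3) Let $A$ be as in (2) and $\xi(k)=\tfrac12kx+\tfrac12\sum_{j\ge1}k^{2j+1}t_{2j+1}$. If $\mathbf K=\mathrm{Diag}(k_1,\dots,k_{n+1})$ and $C^+=(c_1,\dots,c_{n+1},d_1,\dots,d_{n+1})^T$, then $$\varphi=(c_1e^{\xi(k_1)},\dots,c_{n+1}e^{\xi(k_{n+1})},d_1e^{\xi(-\sigma_1k_1^*)},\dots,d_{n+1}e^{\xi(-\sigma_1k_{n+1}^*)})^T.$$ If $\mathbf K$ is the lower triangular $(n+1)\times(n+1)$ Jordan block with eigenvalue $k$, $c$ and $d$ are functions holomorphic near $k$ and near $k^*$ respectively, $C^+=\bigl(\tfrac{1}{j!}c^{(j)}(k)\ (0\le j\le n),\ \tfrac1{j!}d^{(j)}(k^*)\ (0\le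 j\le n)\bigr)^T$, and $\sum_j|t_{2j+1}|R^{2j+1}<\infty$ for some $R>|k|$, then $$\varphi=\Bigl(ce^{\xi(k)},\tfrac{\partial_k}{1!}(ce^{\xi(k)}),\dots,\tfrac{\partial_k^n}{n!}(ce^{\xi(k)}),\ de^{\xi(-\sigma_1k^*)},\tfrac{\partial_{k^*}}{1!}(de^{\xi(-\sigma_1k^*)}),\dots,\tfrac{\partial_{k^*}^n}{n!}(de^{\xi(-\sigma_1k^*)})\Bigr)^T,$$ where $c=c(k)$ and $d=d(k^*)$ are differentiated as functions of $k$ and of $k^*$. -/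

import Mathlib

open scoped ContDiff

noncomputable section

/-! ### Differential polynomials in `q`, `r` and the AKNS hierarchy -/

/-- Differential polynomials in two dependent variables over `ℂ`: the variable `(0, j)` stands for
`∂ₓ^j q` and the variable `(1, j)` stands for `∂ₓ^j r`. -/
abbrev DiffPoly : Type := MvPolynomial (Fin 2 × ℕ) ℂ

namespace DiffPoly

/-- The dependent variable `q`. -/
def q : DiffPoly := MvPolynomial.X (0, 0)

/-- The dependent variable `r`. -/
def r : DiffPoly := MvPolynomial.X (1, 0)

/-- The total `x`-derivative `∂ₓ` on differential polynomials. -/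
def D : Derivation ℂ DiffPoly DiffPoly :=
  MvPolynomial.mkDerivation ℂ fun v => MvPolynomial.X (v.1, v.2 + 1)

open Classical in
/-- The formal antiderivative `∂ₓ⁻¹`: for a differential polynomial `p` which is a total
`x`-derivative, `dInv p` is its antiderivative without constant term (see `dInv_eq` for uniqueness).
The value `0` on differential polynomials which are not total derivatives is never used by the
hierarchy below (see `akns_exact`). -/
def dInv (p : DiffPoly) : DiffPoly :=
  if h : ∃ P : DiffPoly, D P = p ∧ MvPolynomial.constantCoeff P = 0 then h.choose else 0

/-- The recursion operator
`L = (-∂ₓ + 2q∂ₓ⁻¹r, 2q∂ₓ⁻¹q; -2r∂ₓ⁻¹r, ∂ₓ - 2r∂ₓ⁻¹q)` acting on a column `(u₁, u₂)`;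
the two nonlocal terms of each row are combined, `q∂ₓ⁻¹(r u₁) + q∂ₓ⁻¹(q u₂) = q∂ₓ⁻¹(r u₁ + q u₂)`. -/
def recOp (u : DiffPoly × DiffPoly) : DiffPoly × DiffPoly :=
  (-D u.1 + 2 * q * dInv (r * u.1 + q * u.2),
    D u.2 - 2 * r * dInv (r * u.1 + q * u.2))

/-- The right-hand sides `K_n = (K_{1,n}, K_{2,n}) = L^n (-q, r)` of the isospectral AKNS hierarchy. -/
def akns (n : ℕ) : DiffPoly × DiffPoly := recOp^[n] (-q, r)

theorem dInv_spec {p : DiffPoly} (h : ∃ P : DiffPoly, D P = p) :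
    D (dInv p) = p ∧ MvPolynomial.constantCoeff (dInv p) = 0 := by
  have h' : ∃ P : DiffPoly, D P = p ∧ MvPolynomial.constantCoeff P = 0 := by
    obtain ⟨P, hP⟩ := h
    refine ⟨P - MvPolynomial.C (MvPolynomial.constantCoeff P), ?_, by simp⟩
    rw [map_sub, hP]
    simp [D]
  unfold dInv
  rw [dif_pos h']
  exact h'.choose_spec

/-- A differential polynomial with vanishing total derivative is a constant. -/
theorem eq_C_of_D_eq_zero {P : DiffPoly} (h : D P = 0) :
    P = MvPolynomial.C (MvPolynomial.constantCoeff P) := by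
  classical
  have comm : ∀ (a : Fin 2) (m : ℕ) (Q : DiffPoly),
      MvPolynomial.pderiv (a, m + 1) (D Q) =
        D (MvPolynomial.pderiv (a, m + 1) Q) + MvPolynomial.pderiv (a, m) Q := by
    intro a m Q
    induction Q using MvPolynomial.induction_on with
    | C c => simp [D]
    | add Q₁ Q₂ h₁ h₂ => simp only [map_add, h₁, h₂]; ring
    | mul_X Q v hQ =>
      obtain ⟨b, j⟩ := v
      have hX : D (MvPolynomial.X (b, j)) = MvPolynomial.X (b, j + 1) := by
        simp [D, MvPolynomial.mkDerivation_X]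
      have hs : ∀ (v w : Fin 2 × ℕ),
          D ((Pi.single v (1 : DiffPoly) : Fin 2 × ℕ → DiffPoly) w) = 0 := by
        intro v w
        by_cases hvw : w = v
        · subst hvw; simp
        · rw [Pi.single_eq_of_ne hvw]; simp
      simp only [Derivation.leibniz, smul_eq_mul, map_add, hQ, hX, MvPolynomial.pderiv_X, hs]
      have hsh : (Pi.single (a, m + 1) (1 : DiffPoly) : Fin 2 × ℕ → DiffPoly) (b, j + 1) =
          (Pi.single (a, m) (1 : DiffPoly) : Fin 2 × ℕ → DiffPoly) (b, j) := by
        simp [Pi.single_apply]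
      rw [hsh]
      ring
  have hv : ∀ (v : Fin 2 × ℕ), MvPolynomial.pderiv v P = 0 → v ∉ P.vars := by
    intro v hd hmem
    obtain ⟨d, hds, hdv⟩ := MvPolynomial.mem_vars_iff_mem_support v |>.1 hmem
    have hdv' : d v ≠ 0 := Finsupp.mem_support_iff.1 hdv
    have hco := congrArg (MvPolynomial.coeff (d - Finsupp.single v 1)) hd
    have hle : Finsupp.single v 1 ≤ d := by
      rw [Finsupp.single_le_iff]; omega
    rw [MvPolynomial.coeff_pderiv, tsub_add_cancel_of_le hle, MvPolynomial.coeff_zero] at hco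
    rcases mul_eq_zero.1 hco with h0 | h0
    · exact (MvPolynomial.mem_support_iff.1 hds) h0
    · exact Nat.cast_add_one_ne_zero _ h0
  have hnot : ∀ v, v ∉ P.vars → MvPolynomial.pderiv v P = 0 := fun v hv =>
    MvPolynomial.pderiv_eq_zero_of_notMem_vars hv
  have hempty : P.vars = ∅ := by
    by_contra hne
    obtain ⟨v, hvm, hmax⟩ := Finset.exists_max_image P.vars Prod.snd
      (Finset.nonempty_iff_ne_empty.2 hne)
    have hz := comm v.1 v.2 P
    have h1 : (v.1, v.2 + 1) ∉ P.vars := fun hc => by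
      have := hmax _ hc
      simp at this
    rw [h, hnot _ h1] at hz
    simp only [map_zero, zero_add] at hz
    exact hv v hz.symm hvm
  exact MvPolynomial.vars_eq_empty_iff_eq_C.1 hempty

/-- The antiderivative without constant term is unique. -/
theorem dInv_eq {p P : DiffPoly} (hP : D P = p) (h0 : MvPolynomial.constantCoeff P = 0) :
    dInv p = P := by
  obtain ⟨h1, h2⟩ := dInv_spec ⟨P, hP⟩
  have h := eq_C_of_D_eq_zero (P := dInv p - P) (by rw [map_sub, h1, hP, sub_self])
  rw [map_sub, h2, h0, sub_self, map_zero] at h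
  exact sub_eq_zero.1 h

theorem akns_succ (n : ℕ) : akns (n + 1) = recOp (akns n) := by
  simp only [akns, Function.iterate_succ_apply']

/-- All the antiderivatives occurring in the AKNS hierarchy exist as differential polynomials. -/
theorem akns_exact (n : ℕ) : ∃ P : DiffPoly, D P = r * (akns n).1 + q * (akns n).2 := by
  induction n using Nat.strong_induction_on with
  | _ n ih =>
  cases n with
  | zero => exact ⟨0, by simp [akns, mul_comm]⟩
  | succ N =>
    set p : ℕ → DiffPoly := fun k => dInv (r * (akns k).1 + q * (akns k).2) with hp
    have hD : ∀ k, k ≤ N → D (p k) = r * (akns k).1 + q * (akns k).2 := fun k hk =>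
      (dInv_spec (ih k (by omega))).1
    have hb : ∀ k, D (akns k).1 = 2 * q * p k - (akns (k + 1)).1 := by
      intro k; rw [akns_succ]; simp only [recOp, hp]; ring
    have hc : ∀ k, D (akns k).2 = (akns (k + 1)).2 + 2 * r * p k := by
      intro k; rw [akns_succ]; simp only [recOp, hp]; ring
    have key : ∀ M, M ≤ N → ∑ k ∈ Finset.range (M + 1),
        ((akns (k + 1)).1 * (akns (N - k)).2 - (akns k).1 * (akns (N - k + 1)).2) =
        (akns (M + 1)).1 * (akns (N - M)).2 - (akns 0).1 * (akns (N + 1)).2 := by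
      intro M
      induction M with
      | zero => intro _; simp
      | succ M ihM =>
        intro hM
        rw [Finset.sum_range_succ, ihM (by omega)]
        have : N - (M + 1) + 1 = N - M := by omega
        rw [this]; ring
    have hr1 : ∑ k ∈ Finset.range (N + 1),
        (r * (akns k).1 + q * (akns k).2) * p (N - k) =
        ∑ k ∈ Finset.range (N + 1),
        p k * (r * (akns (N - k)).1 + q * (akns (N - k)).2) := by
      rw [← Finset.sum_range_reflect]
      refine Finset.sum_congr rfl fun k hk => ?_
      have hk' := Finset.mem_range.1 hk
      have h1 : N + 1 - 1 - k = N - k := by omega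
      have h2 : N - (N - k) = k := by omega
      rw [h1, h2]; ring
    have hr2 : ∑ k ∈ Finset.range (N + 1), (akns k).1 * p (N - k) =
        ∑ k ∈ Finset.range (N + 1), p k * (akns (N - k)).1 := by
      rw [← Finset.sum_range_reflect]
      refine Finset.sum_congr rfl fun k hk => ?_
      have hk' := Finset.mem_range.1 hk
      have h1 : N + 1 - 1 - k = N - k := by omega
      have h2 : N - (N - k) = k := by omega
      rw [h1, h2]; ring
    refine ⟨∑ k ∈ Finset.range (N + 1), (p k * p (N - k) - (akns k).1 * (akns (N - k)).2), ?_⟩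
    have hK := key N le_rfl
    rw [map_sum]
    have step : ∀ k ∈ Finset.range (N + 1),
        D (p k * p (N - k) - (akns k).1 * (akns (N - k)).2) =
        ((r * (akns k).1 + q * (akns k).2) * p (N - k)
          - p k * (r * (akns (N - k)).1 + q * (akns (N - k)).2))
        + 2 * r * (p k * (akns (N - k)).1 - (akns k).1 * p (N - k))
        + ((akns (k + 1)).1 * (akns (N - k)).2 - (akns k).1 * (akns (N - k + 1)).2) := by
      intro k hk
      have hk' := Finset.mem_range.1 hk
      simp only [map_sub, Derivation.leibniz, smul_eq_mul]
      rw [hD k (by omega), hD (N - k) (by omega), hb, hc]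
      ring
    rw [Finset.sum_congr rfl step, Finset.sum_add_distrib, Finset.sum_add_distrib, hK,
      Finset.sum_sub_distrib, hr1, ← Finset.mul_sum, Finset.sum_sub_distrib, hr2]
    simp [akns]
    ring

/-- The value at the point `t` of a differential polynomial on the pair of functions `u`, `v`
(substituted for `q`, `r`), where functions depend on the variables `t = (t₀, t₁, …)` and `x = t₀`. -/
def evalAt (u v : (ℕ → ℝ) → ℂ) (t : ℕ → ℝ) (p : DiffPoly) : ℂ :=
  MvPolynomial.eval
    (fun w => iteratedDeriv w.2 (fun s : ℝ => (![u, v] w.1) (Function.update t 0 s)) (t 0)) p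

end DiffPoly

/-! ### The complex mKdV hierarchy

The independent variables are the odd-indexed times `t_{2j+1}`, `j = 0, 1, 2, …`, with `t₁ = x`.
They are collected in `t : ℕ → ℝ`, the entry `t j` being `t_{2j+1}`; in particular `t 0 = x`. -/

namespace CmKdV

/-- The reflection `(x, t) ↦ (σ₁ x, σ₂ t)`. -/
def reflect (σ₁ σ₂ : ℝ) (t : ℕ → ℝ) : ℕ → ℝ := fun j => if j = 0 then σ₁ * t j else σ₂ * t j

/-- The reduced potential `r(x, t) = δ q*(σ₁ x, σ₂ t)`. -/
def reducedR (δ σ₁ σ₂ : ℝ) (q : (ℕ → ℝ) → ℂ) : (ℕ → ℝ) → ℂ :=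
  fun t => (δ : ℂ) * starRingEnd ℂ (q (reflect σ₁ σ₂ t))

/-- At the point `t`, `q` solves the member `q_{t_{2l+1}} = K_{1,2l+1}` of the complex mKdV
hierarchy, where `r = δ q*(σ₁ x, σ₂ t)`. The functions `q`, `r` are required to be smooth in `x`
near the point, and the `t_{2l+1}`-derivative of `q` is required to exist. -/
def SolvesAt (δ σ₁ σ₂ : ℝ) (q : (ℕ → ℝ) → ℂ) (l : ℕ) (t : ℕ → ℝ) : Prop :=
  ContDiffAt ℝ ∞ (fun s : ℝ => q (Function.update t 0 s)) (t 0) ∧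
  ContDiffAt ℝ ∞ (fun s : ℝ => reducedR δ σ₁ σ₂ q (Function.update t 0 s)) (t 0) ∧
  HasDerivAt (fun s : ℝ => q (Function.update t l s))
    (DiffPoly.evalAt q (reducedR δ σ₁ σ₂ q) t (DiffPoly.akns (2 * l + 1)).1) (t l)

/-! ### Double Wronskians -/

/-- The double Wronskian `W^{(k, N-k)}(φ, ψ) = |φ, ∂ₓφ, …, ∂ₓ^{k-1}φ; ψ, ∂ₓψ, …, ∂ₓ^{N-k-1}ψ|`
of two column vectors of length `N`, for `k ≤ N`. -/
def doubleWronskian {N : ℕ} (k : ℕ) (φ ψ : (ℕ → ℝ) → Fin N → ℂ) (t : ℕ → ℝ) : ℂ :=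
  Matrix.det (Matrix.of fun i j : Fin N =>
    if (j : ℕ) < k then
      iteratedDeriv (j : ℕ) (fun s : ℝ => φ (Function.update t 0 s) i) (t 0)
    else
      iteratedDeriv ((j : ℕ) - k) (fun s : ℝ => ψ (Function.update t 0 s) i) (t 0))

/-- The denominator `W^{(n+1, n+1)}(φ, ψ)` of the solution. -/
def denom (n : ℕ) (φ ψ : (ℕ → ℝ) → Fin ((n + 1) + (n + 1)) → ℂ) : (ℕ → ℝ) → ℂ :=
  doubleWronskian (n + 1) φ ψ

/-- The ratio `q = 2 W^{(n, n+2)}(φ, ψ) / W^{(n+1, n+1)}(φ, ψ)`. -/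
def ratio (n : ℕ) (φ ψ : (ℕ → ℝ) → Fin ((n + 1) + (n + 1)) → ℂ) : (ℕ → ℝ) → ℂ :=
  fun t => 2 * doubleWronskian n φ ψ t / denom n φ ψ t

/-- The series `∑ A^{2j+1} t_{2j+1}` converges. -/
def Converges {N : ℕ} (A : Matrix (Fin N) (Fin N) ℂ) (t : ℕ → ℝ) : Prop :=
  Summable fun j : ℕ => (t j : ℂ) • A ^ (2 * j + 1)

/-- The exponent `½ ∑ A^{2j+1} t_{2j+1}`. -/
def exponent {N : ℕ} (A : Matrix (Fin N) (Fin N) ℂ) (t : ℕ → ℝ) : Matrix (Fin N) (Fin N) ℂ :=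
  (1 / 2 : ℂ) • ∑' j : ℕ, (t j : ℂ) • A ^ (2 * j + 1)

/-- `φ = exp(½ ∑ A^{2j+1} t_{2j+1}) C⁺`. -/
def phi {N : ℕ} (A : Matrix (Fin N) (Fin N) ℂ) (Cp : Fin N → ℂ) (t : ℕ → ℝ) : Fin N → ℂ :=
  Matrix.mulVec (NormedSpace.exp (exponent A t)) Cp

/-- `ψ = exp(-½ ∑ A^{2j+1} t_{2j+1}) C⁻`. -/
def psi {N : ℕ} (A : Matrix (Fin N) (Fin N) ℂ) (Cm : Fin N → ℂ) (t : ℕ → ℝ) : Fin N → ℂ :=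
  Matrix.mulVec (NormedSpace.exp (-exponent A t)) Cm

/-- Entrywise complex conjugate `M*` of a matrix (no transposition). -/
def conjM {ι κ : Type*} (M : Matrix ι κ ℂ) : Matrix ι κ ℂ := M.map (starRingEnd ℂ)

/-- Entrywise complex conjugate `v*` of a vector. -/
def conjV {ι : Type*} (v : ι → ℂ) : ι → ℂ := fun i => starRingEnd ℂ (v i)

/-! ### The explicit choices of `T`, `A` and `φ` -/

/-- The square matrix of size `2(n+1)` with blocks `M₁, M₂; M₃, M₄` of size `n+1`. -/
def blocks {n : ℕ} (M₁ M₂ M₃ M₄ : Matrix (Fin (n + 1)) (Fin (n + 1)) ℂ) :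
    Matrix (Fin ((n + 1) + (n + 1))) (Fin ((n + 1) + (n + 1))) ℂ :=
  Matrix.reindex finSumFinEquiv finSumFinEquiv (Matrix.fromBlocks M₁ M₂ M₃ M₄)

/-- The matrix `T` with blocks `T₁ = T₄ = 0`, `T₃ = I`, `T₂ = δσ₁ I`: thus `T₂ = I` for
`(σ₁, δ) = (1, 1), (-1, -1)` and `T₂ = -I` for `(σ₁, δ) = (1, -1), (-1, 1)`. -/
def tableT (n : ℕ) (δ σ₁ : ℝ) : Matrix (Fin ((n + 1) + (n + 1))) (Fin ((n + 1) + (n + 1))) ℂ :=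
  blocks 0 (((δ * σ₁ : ℝ) : ℂ) • 1) 1 0

/-- The block diagonal matrix `A` with blocks `K₁ = K`, `K₄ = -σ₁ K*`: thus `K₄ = -K*` for
`σ₁ = 1` and `K₄ = K*` for `σ₁ = -1`. -/
def tableA {n : ℕ} (σ₁ : ℝ) (K : Matrix (Fin (n + 1)) (Fin (n + 1)) ℂ) :
    Matrix (Fin ((n + 1) + (n + 1))) (Fin ((n + 1) + (n + 1))) ℂ :=
  blocks K 0 0 ((-σ₁ : ℂ) • conjM K)

/-- The lower triangular Jordan block `J_{n+1}(k)`. -/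
def jordan (n : ℕ) (k : ℂ) : Matrix (Fin (n + 1)) (Fin (n + 1)) ℂ :=
  Matrix.of fun i j => if i = j then k else if (i : ℕ) = (j : ℕ) + 1 then 1 else 0

/-- `ξ(k) = ½ k x + ½ ∑_{j ≥ 1} k^{2j+1} t_{2j+1}`. -/
def xi (k : ℂ) (t : ℕ → ℝ) : ℂ := (1 / 2 : ℂ) * ∑' j : ℕ, k ^ (2 * j + 1) * (t j : ℂ)

/-- The vector `(F(k), ∂_k F(k) / 1!, …, ∂_k^n F(k) / n!)`. -/
def taylorVec (n : ℕ) (F : ℂ → ℂ) (k : ℂ) : Fin (n + 1) → ℂ :=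
  fun i => iteratedDeriv (i : ℕ) F k / ((i : ℕ).factorial : ℂ)

end CmKdV

end

/-! The proof is a dressing argument. Let B be the matrix with columns φ, …, Aⁿφ, ψ, …, Aⁿψ and let
S be the involution equal to 1 on the span of the first half of the columns and to -1 on that of the
second half. Multiplication by A leaves these spans only at the two last columns, so [A, S] = 2WC
has rank at most two, where C consists of two rows of B⁻¹ (`commutator_invol`, `data_krylov`). Put
M_k = C Aᵏ W, a 2×2 matrix. From CS = σ₃C, SW = -Wσ₃ and S² = 1 it follows that M_k is traceless and
that σ₃ + 2∑ M_k λ^{-k-1} formally squares to 1 (`Data.trace_moment`, `Data.moment_sq`).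

If φ and ψ evolve by ½Aʲ and -½Aʲ, then M₀' = ½[M_j, σ₃]; for j = 1 moreover M_k' = ½[M_{k+1}, σ₃] -
[M₀, M_k]. With q = -(M₀)₀₁ and r = -(M₀)₁₀ the second formula is the AKNS recursion for the
off-diagonal entries of M_k. The nonlocal term needs no integration: ∂ₓ⁻¹(rK₁ + qK₂) is a quadratic
polynomial in earlier members (`aknsAnti_succ`), and the diagonal entries of M_k obey the same
quadratic recursion. Hence K_{1,j} takes the value (M_j)₀₁ (`evalLine_akns`), which by the first
formula is also the derivative of q along the flow of Aʲ.

Cramer's rule identifies the ratio of double Wronskians with -(M₀)₀₁ (`ratio_eq_qCoeff`). For the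
reduction, the antilinear map v ↦ Tv* intertwines A with ±A and carries the columns of B at a point
to multiples of those at the reflected point, with φ and ψ exchanged; comparing coefficients gives r
= δq* at the reflected point (`rCoeff_reflect`).

The explicit φ come from block diagonality. For a Jordan block, the matrix acts on vectors of Taylor
coefficients as multiplication by the variable, so its exponential series acts as multiplication by
exp ξ (`represents_jordan`, `represents_exp`). -/

noncomputable section

/-! ### The AKNS hierarchy as an algebraic recursion, and its evaluation on functions -/

namespace DiffPoly

/-- The antiderivative `∂ₓ⁻¹(r K₁ + q K₂)` occurring in the `k`-th step of the recursion. -/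
def aknsAnti (k : ℕ) : DiffPoly := dInv (r * (akns k).1 + q * (akns k).2)

theorem D_X (v : Fin 2 × ℕ) : D (MvPolynomial.X v) = MvPolynomial.X (v.1, v.2 + 1) := by
  simp [D, MvPolynomial.mkDerivation_X]

theorem D_aknsAnti (k : ℕ) : D (aknsAnti k) = r * (akns k).1 + q * (akns k).2 :=
  (dInv_spec (akns_exact k)).1

theorem constantCoeff_aknsAnti (k : ℕ) : MvPolynomial.constantCoeff (aknsAnti k) = 0 :=
  (dInv_spec (akns_exact k)).2

theorem akns_zero : akns 0 = (-q, r) := rfl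

theorem akns_succ_fst (k : ℕ) :
    (akns (k + 1)).1 = -D (akns k).1 + 2 * q * aknsAnti k := by
  rw [akns_succ]; rfl

theorem akns_succ_snd (k : ℕ) :
    (akns (k + 1)).2 = D (akns k).2 - 2 * r * aknsAnti k := by
  rw [akns_succ]; rfl

theorem constantCoeff_D (p : DiffPoly) : MvPolynomial.constantCoeff (D p) = 0 := by
  induction p using MvPolynomial.induction_on with
  | C c => simp [D]
  | add p₁ p₂ h₁ h₂ => rw [map_add, map_add, h₁, h₂, add_zero]
  | mul_X p v h => simp [Derivation.leibniz, D_X, h]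

theorem constantCoeff_akns (k : ℕ) : MvPolynomial.constantCoeff (akns k).1 = 0 ∧
    MvPolynomial.constantCoeff (akns k).2 = 0 := by
  cases k with
  | zero => simp [akns_zero, q, r]
  | succ k => simp [akns_succ_fst, akns_succ_snd, constantCoeff_D, constantCoeff_aknsAnti]

theorem aknsAnti_zero : aknsAnti 0 = 0 :=
  dInv_eq (by rw [map_zero, akns_zero]; ring) (map_zero _)

/-- The antiderivatives are determined algebraically by the preceding members. -/
theorem aknsAnti_succ (N : ℕ) : aknsAnti (N + 1) = ∑ k ∈ Finset.range (N + 1),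
    (aknsAnti k * aknsAnti (N - k) - (akns k).1 * (akns (N - k)).2) := by
  have hb : ∀ k, D (akns k).1 = 2 * q * aknsAnti k - (akns (k + 1)).1 := by
    intro k; rw [akns_succ_fst]; ring
  have hc : ∀ k, D (akns k).2 = (akns (k + 1)).2 + 2 * r * aknsAnti k := by
    intro k; rw [akns_succ_snd]; ring
  have key : ∀ M, M ≤ N → ∑ k ∈ Finset.range (M + 1),
      ((akns (k + 1)).1 * (akns (N - k)).2 - (akns k).1 * (akns (N - k + 1)).2) =
      (akns (M + 1)).1 * (akns (N - M)).2 - (akns 0).1 * (akns (N + 1)).2 := by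
    intro M
    induction M with
    | zero => intro _; simp
    | succ M ihM =>
      intro hM
      rw [Finset.sum_range_succ, ihM (by omega)]
      have : N - (M + 1) + 1 = N - M := by omega
      rw [this]; ring
  -- Reversing the summation index makes the nonlocal contributions to the derivative cancel in
  -- pairs.
  have hrefl : ∀ f g : ℕ → DiffPoly, ∑ k ∈ Finset.range (N + 1), f k * g (N - k) =
      ∑ k ∈ Finset.range (N + 1), g k * f (N - k) := by
    intro f g
    rw [← Finset.sum_range_reflect]
    refine Finset.sum_congr rfl fun k hk => ?_
    have hk' := Finset.mem_range.1 hk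
    rw [show N + 1 - 1 - k = N - k by omega, show N - (N - k) = k by omega, mul_comm]
  -- By uniqueness of the antiderivative it suffices to differentiate. After the cancellations only
  -- the end terms of the telescoping sum `key` remain, and they are `r * K₁ + q * K₂` at index `N +
  -- 1`.
  refine dInv_eq ?_ ?_
  · rw [map_sum]
    have step : ∀ k ∈ Finset.range (N + 1),
        D (aknsAnti k * aknsAnti (N - k) - (akns k).1 * (akns (N - k)).2) =
        ((r * (akns k).1 + q * (akns k).2) * aknsAnti (N - k)
          - aknsAnti k * (r * (akns (N - k)).1 + q * (akns (N - k)).2))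
        + 2 * r * (aknsAnti k * (akns (N - k)).1 - (akns k).1 * aknsAnti (N - k))
        + ((akns (k + 1)).1 * (akns (N - k)).2 - (akns k).1 * (akns (N - k + 1)).2) := by
      intro k _
      simp only [map_sub, Derivation.leibniz, smul_eq_mul]
      rw [D_aknsAnti, D_aknsAnti, hb, hc]
      ring
    rw [Finset.sum_congr rfl step, Finset.sum_add_distrib, Finset.sum_add_distrib, key N le_rfl,
      Finset.sum_sub_distrib, hrefl (fun k => r * (akns k).1 + q * (akns k).2) aknsAnti,
      ← Finset.mul_sum, Finset.sum_sub_distrib, hrefl (fun k => (akns k).1) aknsAnti]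
    simp [akns_zero]
    ring
  · simp [constantCoeff_aknsAnti, constantCoeff_akns]

/-- Evaluation of differential polynomials on a pair of functions of one variable. -/
def evalLine (f : Fin 2 → ℝ → ℂ) (s : ℝ) : DiffPoly →+* ℂ :=
  MvPolynomial.eval fun w => iteratedDeriv w.2 (f w.1) s

theorem hasDerivAt_evalLine {f : Fin 2 → ℝ → ℂ} {s : ℝ} (hf : ∀ i, ContDiffAt ℝ ∞ (f i) s)
    (p : DiffPoly) : HasDerivAt (fun s => evalLine f s p) (evalLine f s (D p)) s := by
  induction p using MvPolynomial.induction_on with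
  | C c => simpa [evalLine, D] using hasDerivAt_const s c
  | add p₁ p₂ h₁ h₂ =>
    simp only [map_add]
    exact h₁.add h₂
  | mul_X p v h =>
    have hv : HasDerivAt (fun s => evalLine f s (MvPolynomial.X v))
        (evalLine f s (MvPolynomial.X (v.1, v.2 + 1))) s := by
      simp only [evalLine, MvPolynomial.eval_X, iteratedDeriv_succ]
      have h := ((hf v.1).contDiffWithinAt (s := Set.univ)).differentiableWithinAt_iteratedDerivWithin
        (m := v.2) (by exact_mod_cast WithTop.coe_lt_top _) (by simp)
      rw [iteratedDerivWithin_univ, differentiableWithinAt_univ] at h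
      exact h.hasDerivAt
    have := h.mul hv
    simp only [Derivation.leibniz, D_X, smul_eq_mul, map_add, map_mul]
    refine this.congr_deriv ?_
    ring

/-- A solution of the first order recursion together with the quadratic constraint consists of
the values of the AKNS differential polynomials. -/
theorem evalLine_akns {U : Set ℝ} (hU : IsOpen U) {b c p : ℕ → ℝ → ℂ}
    (hb : ∀ k, ∀ s ∈ U, HasDerivAt (b k) (-b (k + 1) s + 2 * b 0 s * p k s) s)
    (hc : ∀ k, ∀ s ∈ U, HasDerivAt (c k) (c (k + 1) s - 2 * c 0 s * p k s) s)
    (hp0 : ∀ s ∈ U, p 0 s = 0)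
    (hp : ∀ k, ∀ s ∈ U, p (k + 1) s =
      -∑ i ∈ Finset.range (k + 1), (p i s * p (k - i) s + b i s * c (k - i) s))
    {f : Fin 2 → ℝ → ℂ} (hf : ∀ i, ContDiffOn ℝ ∞ (f i) U)
    (hf0 : ∀ s ∈ U, f 0 s = -b 0 s) (hf1 : ∀ s ∈ U, f 1 s = -c 0 s) (k : ℕ) :
    ∀ s ∈ U, evalLine f s (akns k).1 = b k s ∧ evalLine f s (akns k).2 = -c k s ∧
      evalLine f s (aknsAnti k) = -p k s := by
  have hq : ∀ s, evalLine f s q = f 0 s := fun s => by simp [evalLine, q]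
  have hr : ∀ s, evalLine f s r = f 1 s := fun s => by simp [evalLine, r]
  -- Values known on the whole open set `U` may be differentiated there; this is why the induction
  -- runs over `U` and not at one point.
  have hD : ∀ (P : DiffPoly) (g : ℝ → ℂ) (g' : ℂ) (s : ℝ), s ∈ U →
      (∀ s ∈ U, evalLine f s P = g s) → HasDerivAt g g' s → evalLine f s (D P) = g' := by
    intro P g g' s hs h hg
    have h1 := hasDerivAt_evalLine (fun i => (hf i).contDiffAt (hU.mem_nhds hs)) P
    refine h1.unique (hg.congr_of_eventuallyEq ?_)
    filter_upwards [hU.mem_nhds hs] with x hx using h x hx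
  induction k using Nat.strong_induction_on with
  | _ k ih =>
  cases k with
  | zero =>
    intro s hs
    simp [akns_zero, aknsAnti_zero, hq, hr, hf0 s hs, hf1 s hs, hp0 s hs]
  | succ k =>
    intro s hs
    refine ⟨?_, ?_, ?_⟩
    · rw [akns_succ_fst]
      simp only [map_add, map_neg, map_mul, map_ofNat, hq]
      rw [hD _ _ _ s hs (fun s hs => (ih k (by omega) s hs).1) (hb k s hs),
        (ih k (by omega) s hs).2.2, hf0 s hs]
      ring
    · rw [akns_succ_snd]
      simp only [map_sub, map_mul, map_ofNat, hr]
      rw [hD _ _ _ s hs (fun s hs => (ih k (by omega) s hs).2.1) (hc k s hs).neg,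
        (ih k (by omega) s hs).2.2, hf1 s hs]
      ring
    · rw [aknsAnti_succ, map_sum, hp k s hs, neg_neg]
      refine Finset.sum_congr rfl fun i hi => ?_
      have hi' := Finset.mem_range.1 hi
      rw [map_sub, map_mul, map_mul, (ih i (by omega) s hs).1, (ih i (by omega) s hs).2.2,
        (ih (k - i) (by omega) s hs).2.1, (ih (k - i) (by omega) s hs).2.2]
      ring

theorem evalAt_eq_evalLine (u v : (ℕ → ℝ) → ℂ) (t : ℕ → ℝ) (p : DiffPoly) :
    evalAt u v t p =
      evalLine (fun i s => (![u, v] i) (Function.update t 0 s)) (t 0) p := rfl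

end DiffPoly

/-! ### The dressed involution and its moments -/

namespace Dressing
open Matrix

variable {ι : Type*} [Fintype ι] [DecidableEq ι]

/-- The Pauli matrix `σ₃`. -/
def pauli : Matrix (Fin 2) (Fin 2) ℂ := diagonal ![1, -1]

theorem pauli_mul_pauli : pauli * pauli = 1 := by
  ext i j; fin_cases i <;> fin_cases j <;> simp [pauli]

/-- The involution which is `1` on the columns of `B` with sign `1` and `-1` on the others. -/
def invol (B Sig : Matrix ι ι ℂ) : Matrix ι ι ℂ := B * Sig * B⁻¹

/-- The column part of the rank two commutator `[A, S]`. -/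
def colPart (B Sig : Matrix ι ι ℂ) (F : Matrix ι (Fin 2) ℂ) : Matrix ι (Fin 2) ℂ :=
  (1 / 2 : ℂ) • (F * pauli - invol B Sig * F)

/-- The `k`-th coefficient of the dressed matrix `σ₃`. -/
def moment (A B Sig : Matrix ι ι ℂ) (E : Matrix (Fin 2) ι ℂ) (F : Matrix ι (Fin 2) ℂ) (k : ℕ) :
    Matrix (Fin 2) (Fin 2) ℂ :=
  E * B⁻¹ * A ^ k * colPart B Sig F

section Algebra

variable {A B Sig : Matrix ι ι ℂ} {E : Matrix (Fin 2) ι ℂ} {F : Matrix ι (Fin 2) ℂ}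

theorem invol_mul_self (hB : B.det ≠ 0) (hS : Sig * Sig = 1) :
    invol B Sig * invol B Sig = 1 := by
  have h := nonsing_inv_mul B (isUnit_iff_ne_zero.2 hB)
  have h' := mul_nonsing_inv B (isUnit_iff_ne_zero.2 hB)
  calc invol B Sig * invol B Sig = B * Sig * (B⁻¹ * B) * Sig * B⁻¹ := by
        simp only [invol, Matrix.mul_assoc]
    _ = B * (Sig * Sig) * B⁻¹ := by rw [h, Matrix.mul_one, Matrix.mul_assoc B]
    _ = 1 := by rw [hS, Matrix.mul_one, h']

theorem row_mul_invol (hB : B.det ≠ 0) (hE : E * Sig = pauli * E) :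
    E * B⁻¹ * invol B Sig = pauli * (E * B⁻¹) := by
  have h := nonsing_inv_mul B (isUnit_iff_ne_zero.2 hB)
  calc E * B⁻¹ * invol B Sig = E * (B⁻¹ * B) * Sig * B⁻¹ := by
        simp only [invol, Matrix.mul_assoc]
    _ = _ := by rw [h, Matrix.mul_one, hE, Matrix.mul_assoc]

/-- With S² = 1, applying S to Fσ₃ - SF gives SFσ₃ - F, which is -(Fσ₃ - SF)σ₃. -/
theorem invol_mul_colPart (hB : B.det ≠ 0) (hS : Sig * Sig = 1) :
    invol B Sig * colPart B Sig F = -(colPart B Sig F * pauli) := by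
  have h := invol_mul_self hB hS
  simp only [colPart, Matrix.mul_smul, Matrix.smul_mul, Matrix.mul_sub, Matrix.sub_mul]
  rw [← Matrix.mul_assoc (invol B Sig) (invol B Sig), h, Matrix.mul_assoc F, pauli_mul_pauli,
    ← smul_neg]
  congr 1
  rw [Matrix.mul_one, Matrix.one_mul, Matrix.mul_assoc]
  abel

/-- The shift relation multiplied by B⁻¹ on the right. It exhibits the commutator as a product
through a space of dimension two. -/
theorem commutator_invol (hB : B.det ≠ 0)
    (hA : A * B * Sig - invol B Sig * (A * B) = (F * pauli - invol B Sig * F) * E) :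
    A * invol B Sig - invol B Sig * A = (2 : ℂ) • (colPart B Sig F * (E * B⁻¹)) := by
  have h' := mul_nonsing_inv B (isUnit_iff_ne_zero.2 hB)
  have := congrArg (· * B⁻¹) hA
  simp only [Matrix.sub_mul] at this
  rw [Matrix.mul_assoc (invol B Sig) (A * B), Matrix.mul_assoc A B B⁻¹, h', Matrix.mul_one] at this
  simp only [colPart, Matrix.smul_mul, smul_smul, Matrix.sub_mul]
  norm_num
  rw [← Matrix.mul_assoc, ← Matrix.mul_assoc, ← this]
  simp only [invol, Matrix.mul_assoc]

theorem pow_commutator (A S : Matrix ι ι ℂ) (k : ℕ) :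
    ∑ i ∈ Finset.range k, A ^ i * (A * S - S * A) * A ^ (k - 1 - i) = A ^ k * S - S * A ^ k := by
  have h : ∀ i ∈ Finset.range k, A ^ i * (A * S - S * A) * A ^ (k - 1 - i) =
      A ^ (i + 1) * S * A ^ (k - (i + 1)) - A ^ i * S * A ^ (k - i) := by
    intro i hi
    have hi' := Finset.mem_range.1 hi
    rw [show k - i = (k - 1 - i) + 1 by omega, show k - (i + 1) = k - 1 - i by omega,
      pow_succ A i, pow_succ' A (k - 1 - i)]
    noncomm_ring
  rw [Finset.sum_congr rfl h, Finset.sum_range_sub fun i => A ^ i * S * A ^ (k - i)]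
  simp

/-- The hypotheses shared by the lemmas on moments. -/
structure Data (A B Sig : Matrix ι ι ℂ) (E : Matrix (Fin 2) ι ℂ) (F : Matrix ι (Fin 2) ℂ) :
    Prop where
  det_ne : B.det ≠ 0
  sig_sq : Sig * Sig = 1
  row_sig : E * Sig = pauli * E
  shift : A * B * Sig - invol B Sig * (A * B) = (F * pauli - invol B Sig * F) * E

/-- C(AᵏS - SAᵏ)W is computed twice: by telescoping into terms Aⁱ[A, S]A^{k-1-i} with [A, S] = 2WC,
and by letting S act on its neighbours C and W. -/
theorem Data.moment_sq (h : Data A B Sig E F) (k : ℕ) :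
    pauli * moment A B Sig E F k + moment A B Sig E F k * pauli +
      (2 : ℂ) • ∑ i ∈ Finset.range k, moment A B Sig E F i * moment A B Sig E F (k - 1 - i) =
      0 := by
  obtain ⟨hB, hS, hE, hA⟩ := h
  have h1 := row_mul_invol hB hE
  have h2 := invol_mul_colPart (F := F) hB hS
  have h3 := commutator_invol hB hA
  have h4 := pow_commutator A (invol B Sig) k
  simp only [moment]
  generalize E * B⁻¹ = C at *
  generalize colPart B Sig F = W at *
  generalize invol B Sig = S at *
  have : (2 : ℂ) • ∑ i ∈ Finset.range k, C * A ^ i * W * (C * A ^ (k - 1 - i) * W) =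
      C * (A ^ k * S - S * A ^ k) * W := by
    rw [← h4, Matrix.mul_sum, Matrix.sum_mul, Finset.smul_sum]
    refine Finset.sum_congr rfl fun i _ => ?_
    rw [h3]
    simp only [Matrix.mul_smul, Matrix.smul_mul, Matrix.mul_assoc]
  rw [this, Matrix.mul_sub, Matrix.sub_mul, ← Matrix.mul_assoc C S, h1]
  have : C * (A ^ k * S) * W = -(C * A ^ k * W * pauli) := by
    rw [← Matrix.mul_assoc, Matrix.mul_assoc (C * A ^ k) S, h2, Matrix.mul_neg]
    simp only [Matrix.mul_assoc]
  rw [this]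
  simp only [Matrix.mul_assoc]
  abel

/-- By cyclicity 2 tr M_k = tr(Aᵏ[A, S]), and this vanishes because Aᵏ commutes with A. -/
theorem Data.trace_moment (h : Data A B Sig E F) (k : ℕ) : (moment A B Sig E F k).trace = 0 := by
  have h3 := commutator_invol h.det_ne h.shift
  have h4 : (A ^ k * (invol B Sig * A)).trace = (A ^ k * (A * invol B Sig)).trace := by
    rw [← Matrix.mul_assoc, trace_mul_comm, ← Matrix.mul_assoc, ← Matrix.mul_assoc, ← pow_succ',
      ← pow_succ]
  have : (2 : ℂ) • (moment A B Sig E F k).trace = 0 := by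
    rw [moment, Matrix.mul_assoc (E * B⁻¹), trace_mul_comm, Matrix.mul_assoc, ← trace_smul,
      ← Matrix.mul_smul, ← h3, Matrix.mul_sub, trace_sub, h4, sub_self]
  simpa using this

end Algebra

section Calculus

/-- Entrywise differentiability of a matrix-valued function. -/
def EntryDeriv {κ μ : Type*} (M : ℝ → Matrix κ μ ℂ) (M' : Matrix κ μ ℂ) (s : ℝ) : Prop :=
  ∀ i j, HasDerivAt (fun s => M s i j) (M' i j) s

variable {κ μ ν : Type*} {s : ℝ}

theorem entryDeriv_const (M : Matrix κ μ ℂ) : EntryDeriv (fun _ => M) 0 s :=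
  fun i j => hasDerivAt_const s (M i j)

theorem EntryDeriv.sub {M N : ℝ → Matrix κ μ ℂ} {M' N' : Matrix κ μ ℂ} (hM : EntryDeriv M M' s)
    (hN : EntryDeriv N N' s) : EntryDeriv (fun s => M s - N s) (M' - N') s :=
  fun i j => (hM i j).sub (hN i j)

theorem EntryDeriv.smul {M : ℝ → Matrix κ μ ℂ} {M' : Matrix κ μ ℂ} (c : ℂ)
    (hM : EntryDeriv M M' s) : EntryDeriv (fun s => c • M s) (c • M') s :=
  fun i j => (hM i j).const_mul c

theorem EntryDeriv.mul [Fintype μ] {M : ℝ → Matrix κ μ ℂ} {N : ℝ → Matrix μ ν ℂ}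
    {M' : Matrix κ μ ℂ} {N' : Matrix μ ν ℂ} (hM : EntryDeriv M M' s) (hN : EntryDeriv N N' s) :
    EntryDeriv (fun s => M s * N s) (M' * N s + M s * N') s := by
  intro i j
  simp only [Matrix.add_apply, Matrix.mul_apply, ← Finset.sum_add_distrib]
  exact HasDerivAt.fun_sum fun k _ => (hM i k).mul (hN k j)

theorem EntryDeriv.unique {M : ℝ → Matrix κ μ ℂ} {M' M'' : Matrix κ μ ℂ}
    (h : EntryDeriv M M' s) (h' : EntryDeriv M M'' s) : M' = M'' :=
  Matrix.ext fun i j => (h i j).unique (h' i j)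

theorem EntryDeriv.congr {M : ℝ → Matrix κ μ ℂ} {M' M'' : Matrix κ μ ℂ}
    (h : EntryDeriv M M' s) (h' : M' = M'') : EntryDeriv M M'' s := h' ▸ h

theorem differentiableAt_det {M : ℝ → Matrix ι ι ℂ}
    (h : ∀ i j, DifferentiableAt ℝ (fun s => M s i j) s) :
    DifferentiableAt ℝ (fun s => (M s).det) s := by
  simp only [Matrix.det_apply]
  refine DifferentiableAt.fun_sum fun τ _ => DifferentiableAt.const_smul ?_ _
  exact (HasDerivAt.fun_finsetProd fun i _ => (h (τ i) i).hasDerivAt).differentiableAt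

/-- Cramer's formula gives differentiability of the inverse; the value of the derivative is then
forced by differentiating B B⁻¹ = 1, valid near `s`. -/
theorem EntryDeriv.inv {B : ℝ → Matrix ι ι ℂ} {B' : Matrix ι ι ℂ} (hB : EntryDeriv B B' s)
    (hdet : (B s).det ≠ 0) :
    EntryDeriv (fun s => (B s)⁻¹) (-((B s)⁻¹ * B' * (B s)⁻¹)) s := by
  have hd : DifferentiableAt ℝ (fun s => (B s).det) s :=
    differentiableAt_det fun i j => (hB i j).differentiableAt
  have hinv : ∀ i j, DifferentiableAt ℝ (fun s => (B s)⁻¹ i j) s := by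
    intro i j
    simp only [Matrix.inv_def, Matrix.smul_apply, Ring.inverse_eq_inv', smul_eq_mul,
      Matrix.adjugate_apply]
    refine (hd.inv hdet).mul (differentiableAt_det fun a b => ?_)
    by_cases ha : a = j
    · subst ha; simp
    · simpa [Matrix.updateRow_ne ha] using (hB a b).differentiableAt
  have hM : EntryDeriv (fun s => (B s)⁻¹)
      (Matrix.of fun i j => deriv (fun s => (B s)⁻¹ i j) s) s := fun i j => (hinv i j).hasDerivAt
  have h1 := hB.mul hM
  have h2 : EntryDeriv (fun s => B s * (B s)⁻¹) 0 s := by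
    intro i j
    refine (entryDeriv_const (1 : Matrix ι ι ℂ) i j).congr_of_eventuallyEq ?_
    filter_upwards [hd.continuousAt.eventually_ne hdet] with x hx
    rw [mul_nonsing_inv _ (isUnit_iff_ne_zero.2 hx)]
  have h3 := h1.unique h2
  generalize (Matrix.of fun i j => deriv (fun s => (B s)⁻¹ i j) s) = M at *
  have h4 : M = -((B s)⁻¹ * B' * (B s)⁻¹) := by
    have h5 := nonsing_inv_mul (B s) (isUnit_iff_ne_zero.2 hdet)
    calc M = (B s)⁻¹ * (B s * M) := by rw [← Matrix.mul_assoc, h5, Matrix.one_mul]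
      _ = _ := by
        rw [eq_neg_of_add_eq_zero_right h3, Matrix.mul_neg, Matrix.mul_assoc]
  rwa [h4] at hM

variable {A Sig G : Matrix ι ι ℂ} {B : ℝ → Matrix ι ι ℂ} {E : Matrix (Fin 2) ι ℂ}
  {F : ℝ → Matrix ι (Fin 2) ℂ}

/-- In the derivative of B Sig B⁻¹ the first term collapses to ½G because Sig² = 1. -/
theorem entryDeriv_invol (hdet : (B s).det ≠ 0) (hS : Sig * Sig = 1)
    (hB : EntryDeriv B ((1 / 2 : ℂ) • (G * B s * Sig)) s) :
    EntryDeriv (fun s => invol (B s) Sig)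
      ((1 / 2 : ℂ) • (G - invol (B s) Sig * G * invol (B s) Sig)) s := by
  have h := (hB.mul (entryDeriv_const Sig)).mul (hB.inv hdet)
  refine h.congr ?_
  have h' := mul_nonsing_inv (B s) (isUnit_iff_ne_zero.2 hdet)
  simp only [invol, Matrix.mul_zero, add_zero, Matrix.smul_mul, Matrix.mul_smul, Matrix.mul_neg]
  rw [Matrix.mul_assoc (G * B s), hS, Matrix.mul_one, Matrix.mul_assoc G, h', Matrix.mul_one]
  simp only [Matrix.mul_assoc]
  module

theorem entryDeriv_colPart (hdet : (B s).det ≠ 0) (hS : Sig * Sig = 1)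
    (hB : EntryDeriv B ((1 / 2 : ℂ) • (G * B s * Sig)) s)
    (hF : EntryDeriv F ((1 / 2 : ℂ) • (G * F s * pauli)) s) :
    EntryDeriv (fun s => colPart (B s) Sig (F s))
      (-(1 / 2 : ℂ) • (invol (B s) Sig * G * colPart (B s) Sig (F s))) s := by
  have h := ((hF.mul (entryDeriv_const pauli)).sub
    ((entryDeriv_invol hdet hS hB).mul hF)).smul (1 / 2 : ℂ)
  refine h.congr ?_
  simp only [colPart, Matrix.mul_zero, add_zero, Matrix.smul_mul, Matrix.mul_smul,
    Matrix.sub_mul, Matrix.mul_sub]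
  rw [Matrix.mul_assoc (G * F s), pauli_mul_pauli, Matrix.mul_one]
  simp only [Matrix.mul_assoc]
  module

/-- The two terms are C' = -½CGS and W' = -½SGW. -/
theorem entryDeriv_moment (hD : Data A (B s) Sig E (F s))
    (hB : EntryDeriv B ((1 / 2 : ℂ) • (G * B s * Sig)) s)
    (hF : EntryDeriv F ((1 / 2 : ℂ) • (G * F s * pauli)) s) (k : ℕ) :
    EntryDeriv (fun s => moment A (B s) Sig E (F s) k)
      (-(1 / 2 : ℂ) • (E * (B s)⁻¹ * G * invol (B s) Sig * A ^ k * colPart (B s) Sig (F s) +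
        E * (B s)⁻¹ * A ^ k * invol (B s) Sig * G * colPart (B s) Sig (F s))) s := by
  have h := (((entryDeriv_const E).mul (hB.inv hD.det_ne)).mul (entryDeriv_const (A ^ k))).mul
    (entryDeriv_colPart hD.det_ne hD.sig_sq hB hF)
  refine h.congr ?_
  simp only [Matrix.zero_mul, zero_add, Matrix.mul_zero, add_zero, Matrix.smul_mul,
    Matrix.mul_smul, Matrix.mul_neg, Matrix.neg_mul, smul_add, neg_smul]
  simp only [invol, Matrix.mul_assoc]

/-- The flow generated by `A ^ j` of the potentials. -/
theorem entryDeriv_moment_zero {j : ℕ} (hD : Data A (B s) Sig E (F s))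
    (hB : EntryDeriv B ((1 / 2 : ℂ) • (A ^ j * B s * Sig)) s)
    (hF : EntryDeriv F ((1 / 2 : ℂ) • (A ^ j * F s * pauli)) s) :
    EntryDeriv (fun s => moment A (B s) Sig E (F s) 0)
      ((1 / 2 : ℂ) • (moment A (B s) Sig E (F s) j * pauli -
        pauli * moment A (B s) Sig E (F s) j)) s := by
  refine (entryDeriv_moment hD hB hF 0).congr ?_
  have h1 := row_mul_invol hD.det_ne hD.row_sig
  have h2 := invol_mul_colPart (F := F s) hD.det_ne hD.sig_sq
  rw [pow_zero, Matrix.mul_one, Matrix.mul_one, h1, Matrix.mul_assoc _ (invol (B s) Sig), h2]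
  simp only [moment, Matrix.mul_neg, Matrix.mul_assoc]
  module

/-- The `x`-derivatives of the moments. -/
theorem entryDeriv_moment_space (hD : Data A (B s) Sig E (F s))
    (hB : EntryDeriv B ((1 / 2 : ℂ) • (A * B s * Sig)) s)
    (hF : EntryDeriv F ((1 / 2 : ℂ) • (A * F s * pauli)) s) (k : ℕ) :
    EntryDeriv (fun s => moment A (B s) Sig E (F s) k)
      ((1 / 2 : ℂ) • (moment A (B s) Sig E (F s) (k + 1) * pauli -
        pauli * moment A (B s) Sig E (F s) (k + 1)) -
        (moment A (B s) Sig E (F s) 0 * moment A (B s) Sig E (F s) k -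
          moment A (B s) Sig E (F s) k * moment A (B s) Sig E (F s) 0)) s := by
  refine (entryDeriv_moment hD hB hF k).congr ?_
  have h1 := row_mul_invol hD.det_ne hD.row_sig
  have h2 := invol_mul_colPart (F := F s) hD.det_ne hD.sig_sq
  have h3 := commutator_invol hD.det_ne hD.shift
  simp only [moment]
  generalize E * (B s)⁻¹ = C at *
  generalize colPart (B s) Sig (F s) = W at *
  generalize invol (B s) Sig = S at *
  -- S is moved across A by [A, S] = 2WC until it meets C or W; each crossing leaves a term
  -- quadratic in the moments, and these form [M₀, M_k].
  have h4 : C * A * S = pauli * C * A + (2 : ℂ) • (C * W * C) := by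
    rw [Matrix.mul_assoc, sub_eq_iff_eq_add'.1 h3, Matrix.mul_add, ← Matrix.mul_assoc C S, h1]
    simp only [Matrix.mul_smul, Matrix.mul_assoc]
  have h5 : S * A * W = -(A * W * pauli) - (2 : ℂ) • (W * C * W) := by
    have h6 : S * A = A * S - (2 : ℂ) • (W * C) := by rw [← h3]; abel
    rw [h6, Matrix.sub_mul, Matrix.mul_assoc, h2, Matrix.smul_mul, Matrix.mul_neg,
      Matrix.mul_assoc A W]
  rw [h4, Matrix.mul_assoc (C * A ^ k), Matrix.mul_assoc (C * A ^ k) (S * A), h5]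
  simp only [Matrix.add_mul, Matrix.mul_sub, Matrix.smul_mul, Matrix.mul_smul, Matrix.mul_neg,
    pow_zero, Matrix.mul_one]
  have h6 : A * (A ^ k * W) = A ^ (k + 1) * W := by rw [← Matrix.mul_assoc, pow_succ']
  have h7 : A ^ k * (A * (W * pauli)) = A ^ (k + 1) * (W * pauli) := by
    rw [← Matrix.mul_assoc, pow_succ]
  simp only [Matrix.mul_assoc, h6, h7]
  module

end Calculus

end Dressing

namespace CmKdV
open Matrix

/-! ### The evolution of φ and ψ in a single time -/

section Flows

section
attribute [local instance] Matrix.linftyOpNormedRing Matrix.linftyOpNormedAlgebra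

theorem hasDerivAt_exp_smul_apply {N : ℕ} (H : Matrix (Fin N) (Fin N) ℂ) (s : ℝ) (i j : Fin N) :
    HasDerivAt (fun u : ℝ => NormedSpace.exp (u • H) i j) ((H * NormedSpace.exp (s • H)) i j) s := by
  have h := hasDerivAt_exp_smul_const' (𝕂 := ℝ) H s
  exact (Matrix.entryLinearMap ℝ ℂ i j).toContinuousLinearMap.hasFDerivAt.comp_hasDerivAt s h

end

variable {N : ℕ} {A : Matrix (Fin N) (Fin N) ℂ} {t : ℕ → ℝ}

theorem update_smul_eq (A : Matrix (Fin N) (Fin N) ℂ) (t : ℕ → ℝ) (l : ℕ) (s : ℝ) :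
    (fun j : ℕ => ((Function.update t l s j : ℝ) : ℂ) • A ^ (2 * j + 1)) =
      Function.update (fun j : ℕ => (t j : ℂ) • A ^ (2 * j + 1)) l ((s : ℂ) • A ^ (2 * l + 1)) := by
  funext j
  by_cases h : j = l
  · subst h; simp
  · simp [h]

theorem Converges.update (h : Converges A t) (l : ℕ) (s : ℝ) :
    Converges A (Function.update t l s) := by
  unfold Converges
  rw [update_smul_eq]
  exact (h.hasSum.update l _).summable

/-- With all other times frozen the exponent is affine in `s`; setting the entry to `0` isolates the
remaining summands. -/
theorem exponent_update (h : Converges A t) (l : ℕ) (s : ℝ) :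
    exponent A (Function.update t l s) =
      s • ((1 / 2 : ℂ) • A ^ (2 * l + 1)) + exponent A (Function.update t l 0) := by
  unfold exponent
  rw [update_smul_eq, update_smul_eq, (h.hasSum.update l _).tsum_eq, (h.hasSum.update l _).tsum_eq,
    ← Complex.coe_smul]
  simp only [Complex.ofReal_zero]
  module

theorem commute_exponent (A : Matrix (Fin N) (Fin N) ℂ) (t : ℕ → ℝ) : Commute A (exponent A t) :=
  (Commute.tsum_right A fun j =>
    ((Commute.refl A).pow_right (2 * j + 1)).smul_right _).smul_right _

/-- Entrywise differentiability of a vector-valued function. -/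
def VecDeriv {κ : Type*} (f : ℝ → κ → ℂ) (f' : κ → ℂ) (s : ℝ) : Prop :=
  ∀ i, HasDerivAt (fun s => f s i) (f' i) s

theorem VecDeriv.mulVec {κ μ : Type*} [Fintype μ] {f : ℝ → μ → ℂ} {f' : μ → ℂ} {s : ℝ}
    (h : VecDeriv f f' s) (M : Matrix κ μ ℂ) :
    VecDeriv (fun s => M *ᵥ f s) (M *ᵥ f') s := by
  intro i
  simp only [Matrix.mulVec, dotProduct]
  exact HasDerivAt.fun_sum fun k _ => (h k).const_mul (M i k)

theorem vecDeriv_exp_mulVec {X H : Matrix (Fin N) (Fin N) ℂ} (hXH : Commute H X) (v : Fin N → ℂ)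
    (s : ℝ) : VecDeriv (fun u : ℝ => NormedSpace.exp (u • H + X) *ᵥ v)
      (H *ᵥ (NormedSpace.exp (s • H + X) *ᵥ v)) s := by
  have h : ∀ u : ℝ, NormedSpace.exp (u • H + X) *ᵥ v =
      NormedSpace.exp (u • H) *ᵥ (NormedSpace.exp X *ᵥ v) := fun u => by
    rw [Matrix.exp_add_of_commute _ _ (hXH.smul_left u), Matrix.mulVec_mulVec]
  simp only [h]
  intro i
  rw [Matrix.mulVec_mulVec]
  simp only [Matrix.mulVec, dotProduct]
  exact HasDerivAt.fun_sum fun k _ => (hasDerivAt_exp_smul_apply H s i k).mul_const _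

theorem vecDeriv_phi (h : Converges A t) (Cp : Fin N → ℂ) (l : ℕ) (s : ℝ) :
    VecDeriv (fun u => phi A Cp (Function.update t l u))
      (((1 / 2 : ℂ) • A ^ (2 * l + 1)) *ᵥ phi A Cp (Function.update t l s)) s := by
  have e : ∀ u, phi A Cp (Function.update t l u) = NormedSpace.exp
      (u • ((1 / 2 : ℂ) • A ^ (2 * l + 1)) + exponent A (Function.update t l 0)) *ᵥ Cp :=
    fun u => by rw [phi, exponent_update h l u]
  simp only [e]
  exact vecDeriv_exp_mulVec (((commute_exponent A _).pow_left _).smul_left _) Cp s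

theorem vecDeriv_psi (h : Converges A t) (Cm : Fin N → ℂ) (l : ℕ) (s : ℝ) :
    VecDeriv (fun u => psi A Cm (Function.update t l u))
      ((-(1 / 2 : ℂ) • A ^ (2 * l + 1)) *ᵥ psi A Cm (Function.update t l s)) s := by
  have e : ∀ u, psi A Cm (Function.update t l u) = NormedSpace.exp
      (u • (-(1 / 2 : ℂ) • A ^ (2 * l + 1)) + -exponent A (Function.update t l 0)) *ᵥ Cm :=
    fun u => by rw [psi, exponent_update h l u, neg_add, neg_smul, smul_neg]
  simp only [e]
  exact vecDeriv_exp_mulVec (X := -exponent A (Function.update t l 0))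
    (((commute_exponent A (Function.update t l 0)).neg_right.pow_left (2 * l + 1)).smul_left
      (-(1 / 2 : ℂ))) Cm s

theorem iteratedDeriv_of_vecDeriv {f : ℝ → Fin N → ℂ} {c : ℂ}
    (h : ∀ s, VecDeriv f ((c • A) *ᵥ f s) s) (j : ℕ) (i : Fin N) :
    iteratedDeriv j (fun s => f s i) = fun s => c ^ j * (A ^ j *ᵥ f s) i := by
  induction j with
  | zero => simp
  | succ j ih =>
    rw [iteratedDeriv_succ, ih]
    funext s
    rw [(((h s).mulVec (A ^ j) i).const_mul (c ^ j)).deriv, Matrix.smul_mulVec,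
      Matrix.mulVec_smul, Matrix.mulVec_mulVec, ← pow_succ, Pi.smul_apply, smul_eq_mul]
    ring

theorem contDiff_of_vecDeriv {f : ℝ → Fin N → ℂ} {c : ℂ}
    (h : ∀ s, VecDeriv f ((c • A) *ᵥ f s) s) (i : Fin N) : ContDiff ℝ ∞ fun s => f s i := by
  refine contDiff_of_differentiable_iteratedDeriv fun j _ s => ?_
  rw [iteratedDeriv_of_vecDeriv h]
  exact (((h s).mulVec (A ^ j) i).const_mul (c ^ j)).differentiableAt

theorem vecDeriv_phi_space (h : Converges A t) (Cp : Fin N → ℂ) (s : ℝ) :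
    VecDeriv (fun u => phi A Cp (Function.update t 0 u))
      (((1 / 2 : ℂ) • A) *ᵥ phi A Cp (Function.update t 0 s)) s := by
  simpa using vecDeriv_phi h Cp 0 s

theorem vecDeriv_psi_space (h : Converges A t) (Cm : Fin N → ℂ) (s : ℝ) :
    VecDeriv (fun u => psi A Cm (Function.update t 0 u))
      ((-(1 / 2 : ℂ) • A) *ᵥ psi A Cm (Function.update t 0 s)) s := by
  simpa using vecDeriv_psi h Cm 0 s

end Flows

/-! ### The Krylov matrix as dressing data -/

section Krylov

variable {n : ℕ}

/-- The square matrix with columns `φ, Aφ, …, Aⁿφ, ψ, Aψ, …, Aⁿψ`. -/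
def krylov (A : Matrix (Fin ((n + 1) + (n + 1))) (Fin ((n + 1) + (n + 1))) ℂ)
    (φ ψ : Fin ((n + 1) + (n + 1)) → ℂ) :
    Matrix (Fin ((n + 1) + (n + 1))) (Fin ((n + 1) + (n + 1))) ℂ :=
  Matrix.of fun i j => Fin.addCases (motive := fun _ => ℂ)
    (fun j : Fin (n + 1) => (A ^ (j : ℕ) *ᵥ φ) i) (fun j => (A ^ (j : ℕ) *ᵥ ψ) i) j

/-- The sign `1` on the first half of the columns and `-1` on the second half. -/
def columnSign (n : ℕ) (j : Fin ((n + 1) + (n + 1))) : ℂ :=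
  Fin.addCases (motive := fun _ => ℂ) (fun _ : Fin (n + 1) => 1) (fun _ => -1) j

/-- The diagonal matrix of the signs `columnSign`. -/
def halfSign (n : ℕ) : Matrix (Fin ((n + 1) + (n + 1))) (Fin ((n + 1) + (n + 1))) ℂ :=
  diagonal (columnSign n)

/-- The rows picking out the coefficients of `Aⁿφ` and of `Aⁿψ`. -/
def lastRows (n : ℕ) : Matrix (Fin 2) (Fin ((n + 1) + (n + 1))) ℂ :=
  Matrix.of ![Pi.single (Fin.castAdd (n + 1) (Fin.last n)) 1,
    Pi.single (Fin.natAdd (n + 1) (Fin.last n)) 1]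

/-- The matrix with columns `Aⁿ⁺¹φ, Aⁿ⁺¹ψ`. -/
def nextCols (A : Matrix (Fin ((n + 1) + (n + 1))) (Fin ((n + 1) + (n + 1))) ℂ)
    (φ ψ : Fin ((n + 1) + (n + 1)) → ℂ) : Matrix (Fin ((n + 1) + (n + 1))) (Fin 2) ℂ :=
  Matrix.of fun i => ![(A ^ (n + 1) *ᵥ φ) i, (A ^ (n + 1) *ᵥ ψ) i]

variable {A : Matrix (Fin ((n + 1) + (n + 1))) (Fin ((n + 1) + (n + 1))) ℂ}
  {φ ψ : Fin ((n + 1) + (n + 1)) → ℂ}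

theorem mul_apply_eq_mulVec {κ μ ν : Type*} [Fintype μ] (M : Matrix κ μ ℂ) (M' : Matrix μ ν ℂ)
    (i : κ) (j : ν) : (M * M') i j = (M *ᵥ fun k => M' k j) i := rfl

theorem krylov_apply_castAdd (i : Fin ((n + 1) + (n + 1))) (j : Fin (n + 1)) :
    krylov A φ ψ i (Fin.castAdd (n + 1) j) = (A ^ (j : ℕ) *ᵥ φ) i := by
  rw [krylov, of_apply, Fin.addCases_left]

theorem krylov_apply_natAdd (i : Fin ((n + 1) + (n + 1))) (j : Fin (n + 1)) :
    krylov A φ ψ i (Fin.natAdd (n + 1) j) = (A ^ (j : ℕ) *ᵥ ψ) i := by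
  rw [krylov, of_apply, Fin.addCases_right]

theorem columnSign_castAdd (j : Fin (n + 1)) : columnSign n (Fin.castAdd (n + 1) j) = 1 :=
  Fin.addCases_left (motive := fun _ => ℂ) j

theorem columnSign_natAdd (j : Fin (n + 1)) : columnSign n (Fin.natAdd (n + 1) j) = -1 :=
  Fin.addCases_right (motive := fun _ => ℂ) j

theorem lastRows_castAdd (j : Fin (n + 1)) :
    lastRows n 0 (Fin.castAdd (n + 1) j) = (if j = Fin.last n then 1 else 0) ∧
      lastRows n 1 (Fin.castAdd (n + 1) j) = 0 := by
  have := j.isLt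
  constructor
  · simp [lastRows, Pi.single_apply, Fin.ext_iff]
  · simp only [lastRows, Matrix.of_apply, Matrix.cons_val_one, Matrix.cons_val_fin_one,
      Pi.single_apply, Fin.ext_iff, Fin.val_castAdd, Fin.val_natAdd, Fin.val_last]
    rw [if_neg (by omega)]

theorem lastRows_natAdd (j : Fin (n + 1)) :
    lastRows n 0 (Fin.natAdd (n + 1) j) = 0 ∧
      lastRows n 1 (Fin.natAdd (n + 1) j) = (if j = Fin.last n then 1 else 0) := by
  constructor
  · simp only [lastRows, Matrix.of_apply, Matrix.cons_val_zero,
      Pi.single_apply, Fin.ext_iff, Fin.val_castAdd, Fin.val_natAdd, Fin.val_last]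
    rw [if_neg (by omega)]
  · simp only [lastRows, Matrix.of_apply, Matrix.cons_val_one, Matrix.cons_val_fin_one,
      Pi.single_apply, Fin.ext_iff, Fin.val_natAdd, Fin.val_last, Nat.add_left_cancel_iff]

theorem krylov_castAdd (j : Fin (n + 1)) :
    (fun i => krylov A φ ψ i (Fin.castAdd (n + 1) j)) = A ^ (j : ℕ) *ᵥ φ :=
  funext fun i => krylov_apply_castAdd i j

theorem krylov_natAdd (j : Fin (n + 1)) :
    (fun i => krylov A φ ψ i (Fin.natAdd (n + 1) j)) = A ^ (j : ℕ) *ᵥ ψ :=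
  funext fun i => krylov_apply_natAdd i j

theorem halfSign_mul_self : halfSign n * halfSign n = 1 := by
  rw [halfSign, diagonal_mul_diagonal, ← diagonal_one]
  congr 1
  funext j
  refine Fin.addCases (fun j => ?_) (fun j => ?_) j
  · rw [columnSign_castAdd, mul_one]
  · rw [columnSign_natAdd]; norm_num

theorem lastRows_mul_halfSign : lastRows n * halfSign n = Dressing.pauli * lastRows n := by
  ext i j
  rw [halfSign, Dressing.pauli, mul_diagonal, diagonal_mul]
  refine Fin.addCases (fun j => ?_) (fun j => ?_) j
  · rw [columnSign_castAdd]
    fin_cases i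
    · simp
    · simp [(lastRows_castAdd j).2]
  · rw [columnSign_natAdd]
    fin_cases i
    · simp only [Fin.zero_eta, (lastRows_natAdd j).1, zero_mul, mul_zero]
    · simp [-Fin.natAdd_eq_addNat]

/-- The shift relation is checked column by column: A moves every column to the next one in the same
eigenspace of S, except the two last columns, whose images are the columns of `nextCols`. -/
theorem data_krylov (hdet : (krylov A φ ψ).det ≠ 0) :
    Dressing.Data A (krylov A φ ψ) (halfSign n) (lastRows n) (nextCols A φ ψ) := by
  refine ⟨hdet, halfSign_mul_self, lastRows_mul_halfSign, ?_⟩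
  have hSB : Dressing.invol (krylov A φ ψ) (halfSign n) * krylov A φ ψ =
      krylov A φ ψ * halfSign n := by
    rw [Dressing.invol, Matrix.mul_assoc, nonsing_inv_mul _ (isUnit_iff_ne_zero.2 hdet),
      Matrix.mul_one]
  set S := Dressing.invol (krylov A φ ψ) (halfSign n) with hS
  have hφ : ∀ j : Fin (n + 1), S *ᵥ (A ^ (j : ℕ) *ᵥ φ) = A ^ (j : ℕ) *ᵥ φ := by
    intro j
    funext i
    have := congrFun₂ hSB i (Fin.castAdd (n + 1) j)
    rw [mul_apply_eq_mulVec, krylov_castAdd, halfSign, mul_diagonal, columnSign_castAdd,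
      krylov_apply_castAdd, mul_one] at this
    exact this
  have hψ : ∀ j : Fin (n + 1), S *ᵥ (A ^ (j : ℕ) *ᵥ ψ) = -(A ^ (j : ℕ) *ᵥ ψ) := by
    intro j
    funext i
    have := congrFun₂ hSB i (Fin.natAdd (n + 1) j)
    rw [mul_apply_eq_mulVec, krylov_natAdd, halfSign, mul_diagonal, columnSign_natAdd,
      krylov_apply_natAdd, mul_neg_one] at this
    exact this
  have hF0 : (fun k => nextCols A φ ψ k 0) = A ^ (n + 1) *ᵥ φ := by funext; simp [nextCols]
  have hF1 : (fun k => nextCols A φ ψ k 1) = A ^ (n + 1) *ᵥ ψ := by funext; simp [nextCols]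
  ext i j
  rw [Matrix.sub_apply, halfSign, mul_diagonal, mul_apply_eq_mulVec A, mul_apply_eq_mulVec S]
  have hcol : (fun k => (A * krylov A φ ψ) k j) = A *ᵥ fun k => krylov A φ ψ k j := rfl
  rw [hcol, Matrix.mul_apply, Fin.sum_univ_two, Matrix.sub_apply, Matrix.sub_apply,
    Dressing.pauli, mul_diagonal, mul_diagonal, mul_apply_eq_mulVec S, mul_apply_eq_mulVec S,
    hF0, hF1]
  refine Fin.addCases (fun j => ?_) (fun j => ?_) j
  · rw [krylov_castAdd, mulVec_mulVec, ← pow_succ', columnSign_castAdd, (lastRows_castAdd j).1,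
      (lastRows_castAdd j).2]
    by_cases hj : j = Fin.last n
    · subst hj
      simp [nextCols]
    · have hj' : (j : ℕ) < n := Fin.val_lt_last hj
      have := hφ ⟨j + 1, by omega⟩
      simp only at this
      rw [this]
      simp [hj]
  · rw [krylov_natAdd, mulVec_mulVec, ← pow_succ', columnSign_natAdd, (lastRows_natAdd j).1,
      (lastRows_natAdd j).2]
    by_cases hj : j = Fin.last n
    · subst hj
      simp [nextCols]
    · have hj' : (j : ℕ) < n := Fin.val_lt_last hj
      have := hψ ⟨j + 1, by omega⟩
      simp only at this
      rw [this]
      simp [hj]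

section

variable {G : Matrix (Fin ((n + 1) + (n + 1))) (Fin ((n + 1) + (n + 1))) ℂ}
  {f g : ℝ → Fin ((n + 1) + (n + 1)) → ℂ} {s : ℝ}

theorem pow_mulVec_smul_comm (hG : Commute A G) (c : ℂ) (j : ℕ) (v : Fin ((n + 1) + (n + 1)) → ℂ) :
    A ^ j *ᵥ ((c • G) *ᵥ v) = c • (G *ᵥ (A ^ j *ᵥ v)) := by
  rw [smul_mulVec, mulVec_smul, mulVec_mulVec, mulVec_mulVec, (hG.pow_left j).eq]

theorem entryDeriv_krylov (hG : Commute A G) (hf : VecDeriv f (((1 / 2 : ℂ) • G) *ᵥ f s) s)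
    (hg : VecDeriv g ((-(1 / 2 : ℂ) • G) *ᵥ g s) s) :
    Dressing.EntryDeriv (fun s => krylov A (f s) (g s))
      ((1 / 2 : ℂ) • (G * krylov A (f s) (g s) * halfSign n)) s := by
  intro i j
  rw [Matrix.smul_apply, halfSign, mul_diagonal, mul_apply_eq_mulVec]
  refine Fin.addCases (fun j => ?_) (fun j => ?_) j
  · have h := (hf.mulVec (A ^ (j : ℕ))) i
    rw [pow_mulVec_smul_comm hG] at h
    rw [krylov_castAdd, columnSign_castAdd]
    simpa [krylov_apply_castAdd] using h
  · have h := (hg.mulVec (A ^ (j : ℕ))) i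
    rw [pow_mulVec_smul_comm hG] at h
    rw [krylov_natAdd, columnSign_natAdd]
    simpa [krylov_apply_natAdd, -Fin.natAdd_eq_addNat] using h

theorem entryDeriv_nextCols (hG : Commute A G) (hf : VecDeriv f (((1 / 2 : ℂ) • G) *ᵥ f s) s)
    (hg : VecDeriv g ((-(1 / 2 : ℂ) • G) *ᵥ g s) s) :
    Dressing.EntryDeriv (fun s => nextCols A (f s) (g s))
      ((1 / 2 : ℂ) • (G * nextCols A (f s) (g s) * Dressing.pauli)) s := by
  have hF0 : (fun k => nextCols A (f s) (g s) k 0) = A ^ (n + 1) *ᵥ f s := by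
    funext; simp [nextCols]
  have hF1 : (fun k => nextCols A (f s) (g s) k 1) = A ^ (n + 1) *ᵥ g s := by
    funext; simp [nextCols]
  intro i j
  rw [Matrix.smul_apply, Dressing.pauli, mul_diagonal, mul_apply_eq_mulVec]
  fin_cases j
  · have h := (hf.mulVec (A ^ (n + 1))) i
    rw [pow_mulVec_smul_comm hG] at h
    simp only [Fin.zero_eta, hF0]
    simpa [nextCols] using h
  · have h := (hg.mulVec (A ^ (n + 1))) i
    rw [pow_mulVec_smul_comm hG] at h
    simp only [Fin.mk_one, hF1]
    simpa [nextCols] using h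

end

/-- The coefficient of `Aⁿφ` in the expansion of `Aⁿ⁺¹ψ` along the columns of `krylov`. -/
def qCoeff (A : Matrix (Fin ((n + 1) + (n + 1))) (Fin ((n + 1) + (n + 1))) ℂ)
    (φ ψ : Fin ((n + 1) + (n + 1)) → ℂ) : ℂ :=
  ((krylov A φ ψ)⁻¹ *ᵥ (A ^ (n + 1) *ᵥ ψ)) (Fin.castAdd (n + 1) (Fin.last n))

/-- The coefficient of `Aⁿψ` in the expansion of `Aⁿ⁺¹φ` along the columns of `krylov`. -/
def rCoeff (A : Matrix (Fin ((n + 1) + (n + 1))) (Fin ((n + 1) + (n + 1))) ℂ)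
    (φ ψ : Fin ((n + 1) + (n + 1)) → ℂ) : ℂ :=
  ((krylov A φ ψ)⁻¹ *ᵥ (A ^ (n + 1) *ᵥ φ)) (Fin.natAdd (n + 1) (Fin.last n))

/-- Since CS = σ₃C, M₀ = ½[CF, σ₃] with F = `nextCols`, so M₀ is the off-diagonal part of CF up to
sign. -/
theorem moment_zero_krylov (hdet : (krylov A φ ψ).det ≠ 0) :
    Dressing.moment A (krylov A φ ψ) (halfSign n) (lastRows n) (nextCols A φ ψ) 0 0 1 =
      -qCoeff A φ ψ ∧
    Dressing.moment A (krylov A φ ψ) (halfSign n) (lastRows n) (nextCols A φ ψ) 0 1 0 =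
      rCoeff A φ ψ := by
  have hF0 : (fun k => nextCols A φ ψ k 0) = A ^ (n + 1) *ᵥ φ := by funext; simp [nextCols]
  have hF1 : (fun k => nextCols A φ ψ k 1) = A ^ (n + 1) *ᵥ ψ := by funext; simp [nextCols]
  have h1 := Dressing.row_mul_invol hdet (lastRows_mul_halfSign (n := n))
  have h : Dressing.moment A (krylov A φ ψ) (halfSign n) (lastRows n) (nextCols A φ ψ) 0 =
      (1 / 2 : ℂ) • (lastRows n * ((krylov A φ ψ)⁻¹ * nextCols A φ ψ) * Dressing.pauli -
        Dressing.pauli * (lastRows n * ((krylov A φ ψ)⁻¹ * nextCols A φ ψ))) := by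
    rw [Dressing.moment, pow_zero, Matrix.mul_one, Dressing.colPart, Matrix.mul_smul,
      Matrix.mul_sub, ← Matrix.mul_assoc _ (Dressing.invol _ _), h1]
    simp only [Matrix.mul_assoc]
  rw [h]
  simp only [Matrix.smul_apply, Matrix.sub_apply, Dressing.pauli, mul_diagonal, diagonal_mul]
  have hr : ∀ (M : Matrix (Fin ((n + 1) + (n + 1))) (Fin 2) ℂ) (j : Fin 2),
      (lastRows n * M) 0 j = M (Fin.castAdd (n + 1) (Fin.last n)) j ∧
      (lastRows n * M) 1 j = M (Fin.natAdd (n + 1) (Fin.last n)) j := by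
    intro M j
    simp [Matrix.mul_apply, lastRows, Pi.single_apply]
  rw [(hr _ _).1, (hr _ _).2, mul_apply_eq_mulVec, mul_apply_eq_mulVec, hF0, hF1]
  simp only [qCoeff, rCoeff]
  constructor
  · simp; ring
  · simp; ring

end Krylov

end CmKdV

namespace CmKdV
open Matrix

/-! ### Double Wronskians and Cramer's rule -/

section Determinants

variable {n : ℕ} {A : Matrix (Fin ((n + 1) + (n + 1))) (Fin ((n + 1) + (n + 1))) ℂ}

/-- The matrix with columns `φ, …, A^{k-1}φ, ψ, Aψ, …`. -/
def doubleKrylov {N : ℕ} (k : ℕ) (A : Matrix (Fin N) (Fin N) ℂ) (φ ψ : Fin N → ℂ) :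
    Matrix (Fin N) (Fin N) ℂ :=
  Matrix.of fun i j => if (j : ℕ) < k then (A ^ (j : ℕ) *ᵥ φ) i else (A ^ ((j : ℕ) - k) *ᵥ ψ) i

/-- The factor by which column `j` of a double Wronskian differs from that of `doubleKrylov`. -/
def columnScale (k j : ℕ) : ℂ := if j < k then (1 / 2) ^ j else (-(1 / 2)) ^ (j - k)

theorem doubleWronskian_eq {N : ℕ} {A : Matrix (Fin N) (Fin N) ℂ} {t : ℕ → ℝ} (h : Converges A t)
    (k : ℕ) (Cp Cm : Fin N → ℂ) : doubleWronskian k (phi A Cp) (psi A Cm) t =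
      (∏ j ∈ Finset.range N, columnScale k j) *
        (doubleKrylov k A (phi A Cp t) (psi A Cm t)).det := by
  rw [← Fin.prod_univ_eq_prod_range, ← Matrix.det_mul_row, doubleWronskian]
  congr 1
  ext i j
  simp only [Matrix.of_apply, doubleKrylov, columnScale]
  rw [iteratedDeriv_of_vecDeriv (vecDeriv_phi_space h Cp),
    iteratedDeriv_of_vecDeriv (vecDeriv_psi_space h Cm)]
  simp only [Function.update_eq_self]
  split_ifs <;> rfl

theorem columnScale_ne_zero (k j : ℕ) : columnScale k j ≠ 0 := by
  unfold columnScale; split_ifs <;> exact pow_ne_zero _ (by norm_num)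

theorem prod_columnScale (a b : ℕ) : ∏ j ∈ Finset.range (a + b), columnScale a j =
    (∏ j ∈ Finset.range a, (1 / 2 : ℂ) ^ j) * ∏ j ∈ Finset.range b, (-(1 / 2) : ℂ) ^ j := by
  rw [Finset.prod_range_add]
  congr 1
  · exact Finset.prod_congr rfl fun j hj => by simp [columnScale, Finset.mem_range.1 hj]
  · exact Finset.prod_congr rfl fun j _ => by simp [columnScale]

/-- Trading the column ∂ₓⁿφ for ∂ₓⁿ⁺¹ψ changes the scale by (-½)ⁿ⁺¹ / (½)ⁿ. This accounts for the
factor 2 in `ratio`, and its sign cancels that of `det_doubleKrylov`. -/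
theorem prod_columnScale_shift (n : ℕ) :
    2 * ∏ j ∈ Finset.range (n + 1 + (n + 1)), columnScale n j =
      (-1) ^ (n + 1) * ∏ j ∈ Finset.range (n + 1 + (n + 1)), columnScale (n + 1) j := by
  rw [prod_columnScale, show n + 1 + (n + 1) = n + (n + 1 + 1) by ring, prod_columnScale,
    Finset.prod_range_succ (fun j => (-(1 / 2) : ℂ) ^ j) (n + 1),
    Finset.prod_range_succ (fun j => (1 / 2 : ℂ) ^ j) n, neg_pow (1 / 2 : ℂ) (n + 1),
    pow_succ (1 / 2 : ℂ)]
  ring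

theorem doubleKrylov_eq_krylov (φ ψ : Fin ((n + 1) + (n + 1)) → ℂ) :
    doubleKrylov (n + 1) A φ ψ = krylov A φ ψ := by
  ext i j
  refine Fin.addCases (fun j => ?_) (fun j => ?_) j
  · rw [krylov_apply_castAdd, doubleKrylov, of_apply, Fin.val_castAdd, if_pos j.isLt]
  · rw [krylov_apply_natAdd, doubleKrylov, of_apply, Fin.val_natAdd, if_neg (by omega),
      Nat.add_sub_cancel_left]

theorem det_doubleKrylov (φ ψ : Fin ((n + 1) + (n + 1)) → ℂ) :
    (doubleKrylov n A φ ψ).det = (-1) ^ (n + 1) *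
      ((krylov A φ ψ).updateCol (Fin.castAdd (n + 1) (Fin.last n)) (A ^ (n + 1) *ᵥ ψ)).det := by
  set a : Fin ((n + 1) + (n + 1)) := Fin.castAdd (n + 1) (Fin.last n) with ha
  set b : Fin ((n + 1) + (n + 1)) := Fin.natAdd (n + 1) (Fin.last n) with hb
  have hav : (a : ℕ) = n := rfl
  have hbv : (b : ℕ) = n + 1 + n := rfl
  have hab : a ≤ b := by rw [Fin.le_def, hav, hbv]; omega
  -- Aⁿ⁺¹ψ sits in the slot of Aⁿφ; moving it to the end is a cycle on the n + 2 columns from `a` to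
  -- `b`, of sign (-1)ⁿ⁺¹.
  have hup : (doubleKrylov n A φ ψ) =
      ((krylov A φ ψ).updateCol a (A ^ (n + 1) *ᵥ ψ)).submatrix id (Fin.cycleIcc a b) := by
    ext i j
    rw [submatrix_apply, id, updateCol_apply, ← doubleKrylov_eq_krylov]
    have hjlt := j.isLt
    by_cases hj : (j : ℕ) < n
    · rw [Fin.cycleIcc_of_lt (by rw [Fin.lt_def, hav]; exact hj),
        if_neg (by rw [Fin.ext_iff]; omega)]
      rw [doubleKrylov, of_apply, doubleKrylov, of_apply, if_pos hj, if_pos (by omega)]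
    · by_cases hj' : j = b
      · rw [hj', Fin.cycleIcc_of_last hab, if_pos rfl]
        simp only [doubleKrylov, of_apply, hbv]
        rw [if_neg (by omega), show n + 1 + n - n = n + 1 by omega]
      · have hlt : (j : ℕ) < n + 1 + n := by
          have : (j : ℕ) ≠ b := fun h => hj' (Fin.ext h)
          omega
        have hv : ((j + 1 : Fin ((n + 1) + (n + 1))) : ℕ) = j + 1 :=
          Fin.val_add_one_of_lt (by rw [Fin.lt_def, Fin.val_last]; omega)
        rw [Fin.cycleIcc_of_ge_of_lt (by rw [Fin.le_def, hav]; omega)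
          (by rw [Fin.lt_def, hbv]; exact hlt), if_neg (by rw [Fin.ext_iff, hv]; omega)]
        simp only [doubleKrylov, of_apply, hv]
        rw [if_neg hj, if_neg (by omega), show (j : ℕ) + 1 - (n + 1) = j - n by omega]
  rw [hup, det_permute', Fin.sign_cycleIcc_of_le hab, hav, hbv,
    show n + 1 + n - n = n + 1 by omega]
  simp

/-- No invertibility is needed: for singular `B` both sides take the default value `0`. -/
theorem inv_mulVec_apply {N : ℕ} (B : Matrix (Fin N) (Fin N) ℂ) (v : Fin N → ℂ) (a : Fin N) :
    (B⁻¹ *ᵥ v) a = (B.updateCol a v).det / B.det := by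
  rw [inv_def, Ring.inverse_eq_inv', smul_mulVec, ← cramer_eq_adjugate_mulVec, Pi.smul_apply,
    cramer_apply, smul_eq_mul, div_eq_inv_mul]

variable {t : ℕ → ℝ}

theorem denom_ne_zero_iff (h : Converges A t) (Cp Cm : Fin ((n + 1) + (n + 1)) → ℂ) :
    denom n (phi A Cp) (psi A Cm) t ≠ 0 ↔ (krylov A (phi A Cp t) (psi A Cm t)).det ≠ 0 := by
  rw [denom, doubleWronskian_eq h, doubleKrylov_eq_krylov, mul_ne_zero_iff,
    and_iff_right (Finset.prod_ne_zero_iff.2 fun j _ => columnScale_ne_zero _ j)]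

theorem ratio_eq_qCoeff (h : Converges A t) (Cp Cm : Fin ((n + 1) + (n + 1)) → ℂ) :
    ratio n (phi A Cp) (psi A Cm) t = qCoeff A (phi A Cp t) (psi A Cm t) := by
  have h0 : ∏ j ∈ Finset.range (n + 1 + (n + 1)), columnScale (n + 1) j ≠ 0 :=
    Finset.prod_ne_zero_iff.2 fun j _ => columnScale_ne_zero _ j
  rw [ratio, denom, doubleWronskian_eq h, doubleWronskian_eq h, doubleKrylov_eq_krylov, qCoeff,
    inv_mulVec_apply, det_doubleKrylov, ← mul_assoc, ← mul_assoc, prod_columnScale_shift]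
  have h1 : ((-1 : ℂ) ^ (n + 1)) * (-1) ^ (n + 1) = 1 := by rw [← mul_pow]; simp
  rw [mul_right_comm ((-1 : ℂ) ^ (n + 1)), h1, one_mul, mul_div_mul_left _ _ h0]

end Determinants

/-! ### The antilinear symmetry v ↦ Tv* -/

section Reduction

theorem conjV_mulVec {κ μ : Type*} [Fintype μ] (M : Matrix κ μ ℂ) (v : μ → ℂ) :
    conjV (M *ᵥ v) = conjM M *ᵥ conjV v := by
  funext i
  simp [conjV, conjM, mulVec, dotProduct, map_sum]

theorem conjV_conjV {κ : Type*} (v : κ → ℂ) : conjV (conjV v) = v := by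
  funext i; simp [conjV]

theorem conjV_smul {κ : Type*} (c : ℂ) (v : κ → ℂ) :
    conjV (c • v) = starRingEnd ℂ c • conjV v := by
  funext i; simp [conjV]

theorem conjV_add {κ : Type*} (v w : κ → ℂ) : conjV (v + w) = conjV v + conjV w := by
  funext i; simp [conjV]

theorem conjV_sum {κ μ : Type*} (s : Finset μ) (f : μ → κ → ℂ) :
    conjV (∑ j ∈ s, f j) = ∑ j ∈ s, conjV (f j) := by
  funext i; simp [conjV]

variable {N : ℕ} {A T : Matrix (Fin N) (Fin N) ℂ} {σ c : ℝ}

theorem mul_conjM_eq (hσ : σ = 1 ∨ σ = -1) (hAT : A * T + (σ : ℂ) • (T * conjM A) = 0) :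
    T * conjM A = (-σ : ℂ) • (A * T) := by
  rw [eq_neg_of_add_eq_zero_left hAT, smul_neg, neg_smul, neg_neg, smul_smul]
  rcases hσ with rfl | rfl <;> simp

theorem mul_conjM_pow (hσ : σ = 1 ∨ σ = -1) (hAT : A * T + (σ : ℂ) • (T * conjM A) = 0) (j : ℕ) :
    T * conjM (A ^ j) = (-σ : ℂ) ^ j • (A ^ j * T) := by
  induction j with
  | zero => simp [conjM]
  | succ j ih =>
    have : conjM (A ^ (j + 1)) = conjM (A ^ j) * conjM A := by
      rw [pow_succ]; exact Matrix.map_mul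
    rw [this, ← Matrix.mul_assoc, ih, Matrix.smul_mul, Matrix.mul_assoc, mul_conjM_eq hσ hAT,
      Matrix.mul_smul, smul_smul, ← pow_succ, ← Matrix.mul_assoc, ← pow_succ]

theorem mulVec_conjV_pow (hσ : σ = 1 ∨ σ = -1) (hAT : A * T + (σ : ℂ) • (T * conjM A) = 0) (j : ℕ)
    (v : Fin N → ℂ) :
    T *ᵥ conjV (A ^ j *ᵥ v) = (-σ : ℂ) ^ j • (A ^ j *ᵥ (T *ᵥ conjV v)) := by
  rw [conjV_mulVec, mulVec_mulVec, mul_conjM_pow hσ hAT, smul_mulVec, mulVec_mulVec]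

theorem mulVec_conjV_involutive (hT : T * conjM T = (c : ℂ) • 1) (v : Fin N → ℂ) :
    T *ᵥ conjV (T *ᵥ conjV v) = (c : ℂ) • v := by
  rw [conjV_mulVec, conjV_conjV, mulVec_mulVec, hT, smul_mulVec, one_mulVec]

theorem continuous_conjM : Continuous fun M : Matrix (Fin N) (Fin N) ℂ => conjM M :=
  continuous_id.matrix_map Complex.continuous_conj

section
attribute [local instance] Matrix.linftyOpNormedRing Matrix.linftyOpNormedAlgebra

theorem exp_conjM (X : Matrix (Fin N) (Fin N) ℂ) :
    NormedSpace.exp (conjM X) = conjM (NormedSpace.exp X) :=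
  (NormedSpace.map_exp (starRingEnd ℂ).mapMatrix continuous_conjM X).symm

end

theorem reflect_eq {σ₁ σ₂ : ℝ} (h : σ₂ = σ₁) (t : ℕ → ℝ) : reflect σ₁ σ₂ t = fun j => σ₁ * t j := by
  subst h; funext j; simp [reflect]

variable {t : ℕ → ℝ}

theorem Converges.const_mul (h : Converges A t) (σ : ℝ) : Converges A fun j => σ * t j := by
  have := Summable.const_smul (σ : ℂ) h
  simpa only [Converges, smul_smul, Complex.ofReal_mul] using this

theorem exponent_const_mul (h : Converges A t) (σ : ℝ) :
    exponent A (fun j => σ * t j) = (σ : ℂ) • exponent A t := by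
  have := Summable.tsum_const_smul (σ : ℂ) h
  rw [exponent, exponent, smul_comm, ← this]
  simp only [smul_smul, Complex.ofReal_mul]

theorem mul_conjM_exponent (hσ : σ = 1 ∨ σ = -1) (hAT : A * T + (σ : ℂ) • (T * conjM A) = 0)
    (h : Converges A t) : T * conjM (exponent A t) = (-σ : ℂ) • (exponent A t * T) := by
  have h1 := h.hasSum.map ((starRingEnd ℂ).mapMatrix : Matrix (Fin N) (Fin N) ℂ →+* _)
    continuous_conjM
  have h2 := h1.mul_left T
  have h3 := (h.hasSum.mul_right T).const_smul (-σ : ℂ)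
  -- Only odd powers of A occur, so each summand picks up the same sign; even flows would not
  -- respect the reduction.
  have hodd : ∀ j : ℕ, (-σ : ℂ) ^ (2 * j + 1) = -σ := by
    intro j
    rcases hσ with rfl | rfl <;> simp [pow_succ]
  have h4 : ∀ j : ℕ, T * ((starRingEnd ℂ).mapMatrix ((t j : ℂ) • A ^ (2 * j + 1))) =
      (-σ : ℂ) • (((t j : ℂ) • A ^ (2 * j + 1)) * T) := by
    intro j
    have : (starRingEnd ℂ).mapMatrix ((t j : ℂ) • A ^ (2 * j + 1)) =
        (t j : ℂ) • conjM (A ^ (2 * j + 1)) := by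
      ext a b; simp [conjM]
    rw [this, Matrix.mul_smul, mul_conjM_pow hσ hAT, hodd, Matrix.smul_mul, smul_comm]
  simp only [Function.comp_def, h4] at h2
  have h5 := h2.unique h3
  have h6 : conjM (exponent A t) = (1 / 2 : ℂ) •
      (starRingEnd ℂ).mapMatrix (∑' j : ℕ, (t j : ℂ) • A ^ (2 * j + 1)) := by
    have h7 : starRingEnd ℂ 2 = 2 := map_ofNat _ 2
    ext a b; simp [conjM, exponent, h7]
  rw [h6, Matrix.mul_smul, h5, exponent, Matrix.smul_mul, smul_comm]

/-- T intertwines the conjugated exponent at the reflected point with minus the exponent at `t`; as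
TT* is a nonzero scalar, T is invertible and the relation passes to the exponentials. -/
theorem psi_eq (hσ : σ = 1 ∨ σ = -1) (hc : c ≠ 0) (hAT : A * T + (σ : ℂ) • (T * conjM A) = 0)
    (hT : T * conjM T = (c : ℂ) • 1) (h : Converges A t) (Cp : Fin N → ℂ) :
    psi A (T *ᵥ conjV Cp) t = T *ᵥ conjV (phi A Cp fun j => σ * t j) := by
  have hc' : (c : ℂ) ≠ 0 := by exact_mod_cast hc
  have hinv : T * ((c : ℂ)⁻¹ • conjM T) = 1 := by
    rw [Matrix.mul_smul, hT, smul_smul, inv_mul_cancel₀ hc', one_smul]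
  have hu : IsUnit T := IsUnit.of_mul_eq_one _ hinv
  have hdet : IsUnit T.det := (isUnit_iff_isUnit_det T).1 hu
  have h1 : T * conjM (exponent A fun j => σ * t j) = -exponent A t * T := by
    rw [exponent_const_mul h]
    have : conjM ((σ : ℂ) • exponent A t) = (σ : ℂ) • conjM (exponent A t) := by
      ext a b; simp [conjM]
    rw [this, Matrix.mul_smul, mul_conjM_exponent hσ hAT h, smul_smul, Matrix.neg_mul,
      ← neg_one_smul ℂ]
    rcases hσ with rfl | rfl <;> simp
  have h2 : -exponent A t = T * conjM (exponent A fun j => σ * t j) * T⁻¹ := by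
    rw [h1, Matrix.mul_assoc, mul_nonsing_inv _ hdet, Matrix.mul_one]
  rw [psi, h2, Matrix.exp_conj _ _ hu, exp_conjM, phi, conjV_mulVec, mulVec_mulVec, mulVec_mulVec,
    Matrix.mul_assoc, nonsing_inv_mul _ hdet, Matrix.mul_one]

end Reduction

/-! ### The symmetry on expansion coefficients -/

section KrylovReduction

variable {n : ℕ} {A T : Matrix (Fin ((n + 1) + (n + 1))) (Fin ((n + 1) + (n + 1))) ℂ} {σ c : ℝ}

/-- The action on coefficients induced by `v ↦ T v*` on the columns of `krylov`. -/
def swapCoeff (σ c : ℝ) (a : Fin ((n + 1) + (n + 1)) → ℂ) : Fin ((n + 1) + (n + 1)) → ℂ :=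
  fun i => Fin.addCases (motive := fun _ => ℂ)
    (fun i : Fin (n + 1) => (c : ℂ) * (-σ) ^ (i : ℕ) * a (Fin.natAdd (n + 1) i))
    (fun i => (-σ : ℂ) ^ (i : ℕ) * a (Fin.castAdd (n + 1) i)) i

theorem swapCoeff_castAdd (a : Fin ((n + 1) + (n + 1)) → ℂ) (i : Fin (n + 1)) :
    swapCoeff σ c a (Fin.castAdd (n + 1) i) =
      (c : ℂ) * (-σ) ^ (i : ℕ) * a (Fin.natAdd (n + 1) i) := by
  rw [swapCoeff, Fin.addCases_left]

theorem swapCoeff_natAdd (a : Fin ((n + 1) + (n + 1)) → ℂ) (i : Fin (n + 1)) :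
    swapCoeff σ c a (Fin.natAdd (n + 1) i) = (-σ : ℂ) ^ (i : ℕ) * a (Fin.castAdd (n + 1) i) := by
  rw [swapCoeff, Fin.addCases_right]

theorem krylov_mulVec (φ ψ a : Fin ((n + 1) + (n + 1)) → ℂ) :
    krylov A φ ψ *ᵥ a = (∑ j : Fin (n + 1), a (Fin.castAdd (n + 1) j) • (A ^ (j : ℕ) *ᵥ φ)) +
      ∑ j : Fin (n + 1), a (Fin.natAdd (n + 1) j) • (A ^ (j : ℕ) *ᵥ ψ) := by
  funext i
  rw [mulVec, dotProduct, Fin.sum_univ_add]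
  simp only [krylov_apply_castAdd, krylov_apply_natAdd, Pi.add_apply, Finset.sum_apply,
    Pi.smul_apply, smul_eq_mul, mul_comm]

/-- In the application `φ` and `φ'` are the values at a point and at its reflection, so the two
Krylov matrices are those at the two points. -/
theorem mulVec_conjV_krylov (hσ : σ = 1 ∨ σ = -1) (hAT : A * T + (σ : ℂ) • (T * conjM A) = 0)
    (hT : T * conjM T = (c : ℂ) • 1) (φ φ' a : Fin ((n + 1) + (n + 1)) → ℂ) :
    T *ᵥ conjV (krylov A φ (T *ᵥ conjV φ') *ᵥ a) =
      krylov A φ' (T *ᵥ conjV φ) *ᵥ swapCoeff σ c (conjV a) := by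
  rw [krylov_mulVec, krylov_mulVec, conjV_add, mulVec_add, conjV_sum, conjV_sum, mulVec_sum,
    mulVec_sum]
  refine (add_comm _ _).trans ?_
  congr 1
  · refine Finset.sum_congr rfl fun j _ => ?_
    rw [conjV_smul, mulVec_smul, mulVec_conjV_pow hσ hAT, mulVec_conjV_involutive hT,
      swapCoeff_castAdd, mulVec_smul, smul_smul, smul_smul]
    congr 1
    simp only [conjV]
    ring
  · refine Finset.sum_congr rfl fun j _ => ?_
    rw [conjV_smul, mulVec_smul, mulVec_conjV_pow hσ hAT, swapCoeff_natAdd, smul_smul]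
    congr 1
    simp only [conjV]
    ring

theorem swapCoeff_eq_zero (hσ : σ = 1 ∨ σ = -1) (hc : c ≠ 0) {a : Fin ((n + 1) + (n + 1)) → ℂ}
    (h : swapCoeff σ c (conjV a) = 0) : a = 0 := by
  have hσ' : (-σ : ℂ) ≠ 0 := by rcases hσ with rfl | rfl <;> simp
  have hc' : (c : ℂ) ≠ 0 := by exact_mod_cast hc
  funext i
  refine Fin.addCases (fun i => ?_) (fun i => ?_) i
  · have := congrFun h (Fin.natAdd (n + 1) i)
    rw [swapCoeff_natAdd] at this
    simpa [conjV, hσ'] using this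
  · have := congrFun h (Fin.castAdd (n + 1) i)
    rw [swapCoeff_castAdd] at this
    simpa [conjV, hσ', hc', -Fin.natAdd_eq_addNat] using this

/-- A kernel vector at one point is carried by `swapCoeff` to a nonzero kernel vector at the other.
-/
theorem det_krylov_reflect (hσ : σ = 1 ∨ σ = -1) (hc : c ≠ 0)
    (hAT : A * T + (σ : ℂ) • (T * conjM A) = 0) (hT : T * conjM T = (c : ℂ) • 1)
    {φ φ' : Fin ((n + 1) + (n + 1)) → ℂ} (hdet : (krylov A φ (T *ᵥ conjV φ')).det ≠ 0) :
    (krylov A φ' (T *ᵥ conjV φ)).det ≠ 0 := by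
  intro h0
  obtain ⟨a, ha, ha'⟩ := exists_mulVec_eq_zero_iff.2 h0
  have h1 := mulVec_conjV_krylov hσ hAT hT φ' φ a
  rw [ha'] at h1
  have h2 : conjV (0 : Fin ((n + 1) + (n + 1)) → ℂ) = 0 := by funext i; simp [conjV]
  rw [h2, mulVec_zero] at h1
  refine ha (swapCoeff_eq_zero hσ hc ?_)
  by_contra hne
  exact hdet (exists_mulVec_eq_zero_iff.1 ⟨_, hne, h1.symm⟩)

/-- The symmetry is applied to the expansion of Aⁿ⁺¹ψ, which becomes that of a multiple of Aⁿ⁺¹φ';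
the coefficient at the last column is compared. -/
theorem rCoeff_reflect (hσ : σ = 1 ∨ σ = -1) (hc : c ≠ 0)
    (hAT : A * T + (σ : ℂ) • (T * conjM A) = 0) (hT : T * conjM T = (c : ℂ) • 1)
    {φ φ' : Fin ((n + 1) + (n + 1)) → ℂ} (hdet : (krylov A φ (T *ᵥ conjV φ')).det ≠ 0) :
    (σ * c : ℂ) * rCoeff A φ' (T *ᵥ conjV φ) =
      -starRingEnd ℂ (qCoeff A φ (T *ᵥ conjV φ')) := by
  have hdet' := det_krylov_reflect hσ hc hAT hT hdet
  have h1 := mulVec_conjV_krylov hσ hAT hT φ φ'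
    ((krylov A φ (T *ᵥ conjV φ'))⁻¹ *ᵥ (A ^ (n + 1) *ᵥ (T *ᵥ conjV φ')))
  rw [mulVec_mulVec, mul_nonsing_inv _ (isUnit_iff_ne_zero.2 hdet), one_mulVec,
    mulVec_conjV_pow hσ hAT, mulVec_conjV_involutive hT] at h1
  have h2 := congrFun (congrArg ((krylov A φ' (T *ᵥ conjV φ))⁻¹ *ᵥ ·) h1)
    (Fin.natAdd (n + 1) (Fin.last n))
  simp only [mulVec_smul] at h2
  rw [mulVec_mulVec _ _ (krylov A φ' (T *ᵥ conjV φ)),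
    nonsing_inv_mul _ (isUnit_iff_ne_zero.2 hdet'), one_mulVec, swapCoeff_natAdd, Pi.smul_apply,
    Pi.smul_apply, Fin.val_last] at h2
  have hσ' : (-σ : ℂ) ≠ 0 := by rcases hσ with rfl | rfl <;> simp
  change (-σ : ℂ) ^ (n + 1) • (c : ℂ) • rCoeff A φ' (T *ᵥ conjV φ) =
    (-σ : ℂ) ^ n * starRingEnd ℂ (qCoeff A φ (T *ᵥ conjV φ')) at h2
  rw [pow_succ, smul_eq_mul, smul_eq_mul, mul_assoc] at h2
  rw [← mul_left_cancel₀ (pow_ne_zero n hσ') h2]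
  ring

end KrylovReduction

end CmKdV

/-! ### Entries of the moments and the solution of the hierarchy -/

namespace Dressing
open Matrix

variable {ι : Type*} [Fintype ι] [DecidableEq ι] {A B Sig : Matrix ι ι ℂ}
  {E : Matrix (Fin 2) ι ℂ} {F : Matrix ι (Fin 2) ℂ}

theorem pauli_mul_apply {κ : Type*} (M : Matrix (Fin 2) κ ℂ) (j : κ) :
    (pauli * M) 0 j = M 0 j ∧ (pauli * M) 1 j = -M 1 j := by
  constructor <;> rw [pauli, diagonal_mul] <;> simp

theorem mul_pauli_apply {κ : Type*} (M : Matrix κ (Fin 2) ℂ) (i : κ) :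
    (M * pauli) i 0 = M i 0 ∧ (M * pauli) i 1 = -M i 1 := by
  constructor <;> rw [pauli, mul_diagonal] <;> simp

theorem Data.moment_one_one (h : Data A B Sig E F) (k : ℕ) :
    moment A B Sig E F k 1 1 = -moment A B Sig E F k 0 0 := by
  have := h.trace_moment k
  rw [trace_fin_two] at this
  exact eq_neg_of_add_eq_zero_right this

theorem Data.moment_zero_zero (h : Data A B Sig E F) (k : ℕ) :
    moment A B Sig E F k 0 0 = -∑ i ∈ Finset.range k,
      (moment A B Sig E F i 0 0 * moment A B Sig E F (k - 1 - i) 0 0 +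
        moment A B Sig E F i 0 1 * moment A B Sig E F (k - 1 - i) 1 0) := by
  have h1 := congrFun₂ (h.moment_sq k) 0 0
  simp only [Matrix.add_apply, Matrix.smul_apply, (pauli_mul_apply _ _).1,
    (mul_pauli_apply _ _).1, Matrix.sum_apply, Matrix.zero_apply, smul_eq_mul] at h1
  simp only [Matrix.mul_apply, Fin.sum_univ_two] at h1
  linear_combination h1 / 2

end Dressing

namespace CmKdV
open Matrix

section Solution

variable {n : ℕ} {A T : Matrix (Fin ((n + 1) + (n + 1))) (Fin ((n + 1) + (n + 1))) ℂ}
  {f g : ℝ → Fin ((n + 1) + (n + 1)) → ℂ}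

theorem contDiff_det {N : ℕ} {M : ℝ → Matrix (Fin N) (Fin N) ℂ} {s : ℝ}
    (h : ∀ i j, ContDiffAt ℝ ∞ (fun s => M s i j) s) :
    ContDiffAt ℝ ∞ (fun s => (M s).det) s := by
  simp only [Matrix.det_apply]
  exact ContDiffAt.sum fun τ _ => ContDiffAt.const_smul _ (contDiffAt_prod fun i _ => h (τ i) i)

theorem contDiff_mulVec {κ μ : Type*} [Fintype μ] {v : ℝ → μ → ℂ} {s : ℝ}
    (h : ∀ i, ContDiffAt ℝ ∞ (fun s => v s i) s) (M : Matrix κ μ ℂ) (i : κ) :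
    ContDiffAt ℝ ∞ (fun s => (M *ᵥ v s) i) s := by
  simp only [mulVec, dotProduct]
  exact ContDiffAt.sum fun k _ => contDiffAt_const.mul (h k)

theorem contDiff_krylov {s : ℝ} (hf : ∀ i, ContDiffAt ℝ ∞ (fun s => f s i) s)
    (hg : ∀ i, ContDiffAt ℝ ∞ (fun s => g s i) s) (i j : Fin ((n + 1) + (n + 1))) :
    ContDiffAt ℝ ∞ (fun s => krylov A (f s) (g s) i j) s := by
  refine Fin.addCases (fun j => ?_) (fun j => ?_) j
  · simp only [krylov_apply_castAdd]
    exact contDiff_mulVec hf _ i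
  · simp only [krylov_apply_natAdd]
    exact contDiff_mulVec hg _ i

theorem contDiff_inv_mulVec {N : ℕ} {B : ℝ → Matrix (Fin N) (Fin N) ℂ} {v : ℝ → Fin N → ℂ} {s : ℝ}
    (hB : ∀ i j, ContDiffAt ℝ ∞ (fun s => B s i j) s) (hv : ∀ i, ContDiffAt ℝ ∞ (fun s => v s i) s)
    (hdet : (B s).det ≠ 0) (a : Fin N) : ContDiffAt ℝ ∞ (fun s => ((B s)⁻¹ *ᵥ v s) a) s := by
  simp only [inv_mulVec_apply, div_eq_mul_inv]
  refine ContDiffAt.mul (contDiff_det fun i j => ?_) ((contDiff_det hB).inv hdet)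
  by_cases h : j = a
  · subst h; simpa using hv i
  · simpa [updateCol_ne h] using hB i j

theorem contDiff_qCoeff {s : ℝ} (hf : ∀ i, ContDiffAt ℝ ∞ (fun s => f s i) s)
    (hg : ∀ i, ContDiffAt ℝ ∞ (fun s => g s i) s) (hdet : (krylov A (f s) (g s)).det ≠ 0) :
    ContDiffAt ℝ ∞ (fun s => qCoeff A (f s) (g s)) s :=
  contDiff_inv_mulVec (contDiff_krylov hf hg) (contDiff_mulVec hg _) hdet _

theorem contDiff_rCoeff {s : ℝ} (hf : ∀ i, ContDiffAt ℝ ∞ (fun s => f s i) s)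
    (hg : ∀ i, ContDiffAt ℝ ∞ (fun s => g s i) s) (hdet : (krylov A (f s) (g s)).det ≠ 0) :
    ContDiffAt ℝ ∞ (fun s => rCoeff A (f s) (g s)) s :=
  contDiff_inv_mulVec (contDiff_krylov hf hg) (contDiff_mulVec hf _) hdet _

/-- The moments of the matrix `krylov`. -/
def krylovMoment (A : Matrix (Fin ((n + 1) + (n + 1))) (Fin ((n + 1) + (n + 1))) ℂ)
    (φ ψ : Fin ((n + 1) + (n + 1)) → ℂ) (k : ℕ) : Matrix (Fin 2) (Fin 2) ℂ :=
  Dressing.moment A (krylov A φ ψ) (halfSign n) (lastRows n) (nextCols A φ ψ) k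

/-- Along the `x`-flow the AKNS differential polynomials of the two coefficients are moments. -/
theorem evalLine_akns_krylov {U : Set ℝ} (hU : IsOpen U)
    (hf : ∀ s, VecDeriv f (((1 / 2 : ℂ) • A) *ᵥ f s) s)
    (hg : ∀ s, VecDeriv g ((-(1 / 2 : ℂ) • A) *ᵥ g s) s)
    (hdet : ∀ s ∈ U, (krylov A (f s) (g s)).det ≠ 0) {w : Fin 2 → ℝ → ℂ}
    (hw0 : ∀ s ∈ U, w 0 s = qCoeff A (f s) (g s))
    (hw1 : ∀ s ∈ U, w 1 s = -rCoeff A (f s) (g s)) (k : ℕ) {s : ℝ} (hs : s ∈ U) :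
    (∀ i, ContDiffOn ℝ ∞ (w i) U) ∧
    DiffPoly.evalLine w s (DiffPoly.akns k).1 = krylovMoment A (f s) (g s) k 0 1 := by
  have hcf : ∀ s i, ContDiffAt ℝ ∞ (fun s => f s i) s := fun s i =>
    (contDiff_of_vecDeriv hf i).contDiffAt
  have hcg : ∀ s i, ContDiffAt ℝ ∞ (fun s => g s i) s := fun s i =>
    (contDiff_of_vecDeriv hg i).contDiffAt
  have hw : ∀ i, ContDiffOn ℝ ∞ (w i) U := by
    intro i
    fin_cases i
    · exact ContDiffOn.congr (fun s hs =>
        (contDiff_qCoeff (hcf s) (hcg s) (hdet s hs)).contDiffWithinAt) hw0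
    · exact ContDiffOn.congr (fun s hs =>
        (contDiff_rCoeff (hcf s) (hcg s) (hdet s hs)).neg.contDiffWithinAt) hw1
  refine ⟨hw, ?_⟩
  have hD : ∀ s ∈ U, Dressing.Data A (krylov A (f s) (g s)) (halfSign n) (lastRows n)
      (nextCols A (f s) (g s)) := fun s hs => data_krylov (hdet s hs)
  have hd : ∀ k, ∀ s ∈ U, _ := fun k s hs => Dressing.entryDeriv_moment_space (hD s hs)
    (entryDeriv_krylov (Commute.refl A) (hf s) (hg s))
    (entryDeriv_nextCols (Commute.refl A) (hf s) (hg s)) k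
  -- The quadratic sum is empty at index `0`, so M₀ is off-diagonal.
  have hp0 : ∀ s ∈ U, krylovMoment A (f s) (g s) 0 0 0 = 0 := fun s hs => by
    rw [krylovMoment, (hD s hs).moment_zero_zero]; simp
  have h00 : ∀ s ∈ U, krylovMoment A (f s) (g s) 0 1 1 = 0 := fun s hs => by
    rw [krylovMoment, (hD s hs).moment_one_one, ← krylovMoment, hp0 s hs, neg_zero]
  have hM : ∀ k s, Dressing.moment A (krylov A (f s) (g s)) (halfSign n) (lastRows n)
      (nextCols A (f s) (g s)) k = krylovMoment A (f s) (g s) k := fun _ _ => rfl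
  have h11 : ∀ k, ∀ s ∈ U, krylovMoment A (f s) (g s) k 1 1 = -krylovMoment A (f s) (g s) k 0 0 :=
    fun k s hs => (hD s hs).moment_one_one k
  refine (DiffPoly.evalLine_akns hU (b := fun k s => krylovMoment A (f s) (g s) k 0 1)
    (c := fun k s => krylovMoment A (f s) (g s) k 1 0)
    (p := fun k s => krylovMoment A (f s) (g s) k 0 0) ?_ ?_ hp0 ?_ hw ?_ ?_ k s hs).1
  · intro k s hs
    refine (hd k s hs 0 1).congr_deriv ?_
    simp only [hM, Matrix.sub_apply, Matrix.smul_apply, (Dressing.pauli_mul_apply _ _).1,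
      (Dressing.mul_pauli_apply _ _).2, smul_eq_mul]
    simp only [Matrix.mul_apply, Fin.sum_univ_two, hp0 s hs, h00 s hs, h11 k s hs]
    ring
  · intro k s hs
    refine (hd k s hs 1 0).congr_deriv ?_
    simp only [hM, Matrix.sub_apply, Matrix.smul_apply, (Dressing.pauli_mul_apply _ _).2,
      (Dressing.mul_pauli_apply _ _).1, smul_eq_mul]
    simp only [Matrix.mul_apply, Fin.sum_univ_two, hp0 s hs, h00 s hs, h11 k s hs]
    ring
  · intro k s hs
    exact (hD s hs).moment_zero_zero (k + 1)
  · intro s hs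
    rw [hw0 s hs, krylovMoment, (moment_zero_krylov (hdet s hs)).1, neg_neg]
  · intro s hs
    rw [hw1 s hs, krylovMoment, (moment_zero_krylov (hdet s hs)).2]

/-- The (0,1) entry of ½[M_j, σ₃] is -(M_j)₀₁, and q = -(M₀)₀₁. -/
theorem hasDerivAt_qCoeff {j : ℕ} {s : ℝ}
    (hf : VecDeriv f (((1 / 2 : ℂ) • A ^ j) *ᵥ f s) s)
    (hg : VecDeriv g ((-(1 / 2 : ℂ) • A ^ j) *ᵥ g s) s)
    (hdet : (krylov A (f s) (g s)).det ≠ 0) :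
    HasDerivAt (fun s => qCoeff A (f s) (g s)) (krylovMoment A (f s) (g s) j 0 1) s := by
  have hB := entryDeriv_krylov ((Commute.refl A).pow_right j) hf hg
  have hF := entryDeriv_nextCols ((Commute.refl A).pow_right j) hf hg
  have h := (Dressing.entryDeriv_moment_zero (data_krylov hdet) hB hF 0 1).neg
  have hcont := (Dressing.differentiableAt_det fun i j =>
    (hB i j).differentiableAt).continuousAt.eventually_ne hdet
  refine (h.congr_of_eventuallyEq ?_).congr_deriv ?_
  · filter_upwards [hcont] with x hx
    simp only [Pi.neg_apply, (moment_zero_krylov hx).1, neg_neg]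
  · rw [krylovMoment, Matrix.smul_apply, Matrix.sub_apply, (Dressing.pauli_mul_apply _ _).1,
      (Dressing.mul_pauli_apply _ _).2, smul_eq_mul]
    ring

theorem eventually_det_krylov_ne_zero {G : Matrix (Fin ((n + 1) + (n + 1))) _ ℂ} {s : ℝ}
    (hG : Commute A G) (hf : VecDeriv f (((1 / 2 : ℂ) • G) *ᵥ f s) s)
    (hg : VecDeriv g ((-(1 / 2 : ℂ) • G) *ᵥ g s) s) (hdet : (krylov A (f s) (g s)).det ≠ 0) :
    ∀ᶠ u in nhds s, (krylov A (f u) (g u)).det ≠ 0 :=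
  (Dressing.differentiableAt_det fun i j =>
    (entryDeriv_krylov hG hf hg i j).differentiableAt).continuousAt.eventually_ne hdet

/-- The x-flow evaluates K_{1,2l+1} to an entry of a moment, and the flow of A^{2l+1} gives the same
entry as derivative of q; the symmetry identifies the second potential with the reduced one. -/
theorem solvesAt_ratio {δ σ₁ σ₂ : ℝ} (hδ : δ = 1 ∨ δ = -1) (hσ₁ : σ₁ = 1 ∨ σ₁ = -1)
    (hσ : σ₂ = σ₁) (hAT : A * T + (σ₁ : ℂ) • (T * conjM A) = 0)
    (hT : T * conjM T = ((δ * σ₁ : ℝ) : ℂ) • 1) (Cp : Fin ((n + 1) + (n + 1)) → ℂ) {t : ℕ → ℝ}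
    (ht : Converges A t) (hden : denom n (phi A Cp) (psi A (T *ᵥ conjV Cp)) t ≠ 0) :
    denom n (phi A Cp) (psi A (T *ᵥ conjV Cp)) (reflect σ₁ σ₂ t) ≠ 0 ∧
      ∀ l, SolvesAt δ σ₁ σ₂ (ratio n (phi A Cp) (psi A (T *ᵥ conjV Cp))) l t := by
  set Cm := T *ᵥ conjV Cp with hCm
  have hδ0 : δ ≠ 0 := by rcases hδ with rfl | rfl <;> norm_num
  have hσ0 : σ₁ ≠ 0 := by rcases hσ₁ with rfl | rfl <;> norm_num
  have hc : δ * σ₁ ≠ 0 := mul_ne_zero hδ0 hσ0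
  have hσσ : σ₁ * σ₁ = 1 := by rcases hσ₁ with rfl | rfl <;> norm_num
  have hδδ : δ * δ = 1 := by rcases hδ with rfl | rfl <;> norm_num
  have hpsi : ∀ t, Converges A t → psi A Cm t = T *ᵥ conjV (phi A Cp (reflect σ₁ σ₂ t)) := by
    intro t ht
    rw [reflect_eq hσ]
    exact psi_eq hσ₁ hc hAT hT ht Cp
  have hrefl : ∀ t, reflect σ₁ σ₂ (reflect σ₁ σ₂ t) = t := by
    intro t
    rw [reflect_eq hσ, reflect_eq hσ]
    funext j
    rw [← mul_assoc, hσσ, one_mul]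
  have hconv : ∀ t, Converges A t → Converges A (reflect σ₁ σ₂ t) := by
    intro t ht
    rw [reflect_eq hσ]
    exact ht.const_mul σ₁
  have hpsi' : ∀ t, Converges A t → psi A Cm (reflect σ₁ σ₂ t) = T *ᵥ conjV (phi A Cp t) := by
    intro t ht
    rw [hpsi _ (hconv t ht), hrefl]
  have hdet' : ∀ t, Converges A t → (krylov A (phi A Cp t) (psi A Cm t)).det ≠ 0 →
      (krylov A (phi A Cp (reflect σ₁ σ₂ t)) (psi A Cm (reflect σ₁ σ₂ t))).det ≠ 0 := by
    intro t ht h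
    rw [hpsi t ht] at h
    rw [hpsi' t ht]
    exact det_krylov_reflect hσ₁ hc hAT hT h
  have hr : ∀ t, Converges A t → (krylov A (phi A Cp t) (psi A Cm t)).det ≠ 0 →
      reducedR δ σ₁ σ₂ (ratio n (phi A Cp) (psi A Cm)) t =
        -rCoeff A (phi A Cp t) (psi A Cm t) := by
    intro t ht h
    have h1 := hdet' t ht h
    rw [hpsi' t ht] at h1
    -- Used with the two points exchanged: q is taken at the reflected point and the other
    -- coefficient at `t`.
    have h2 := rCoeff_reflect hσ₁ hc hAT hT h1
    rw [reducedR, ratio_eq_qCoeff (hconv t ht), hpsi' t ht, hpsi t ht]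
    have h3 : (σ₁ * (δ * σ₁ : ℝ) : ℂ) = δ := by
      rw [← Complex.ofReal_mul, mul_left_comm, hσσ, mul_one]
    rw [h3] at h2
    have h4 : (δ : ℂ) * δ = 1 := by rw [← Complex.ofReal_mul, hδδ, Complex.ofReal_one]
    linear_combination (δ : ℂ) * h2 - rCoeff A (phi A Cp t)
      (T *ᵥ conjV (phi A Cp (reflect σ₁ σ₂ t))) * h4
  have hdet := (denom_ne_zero_iff ht Cp Cm).1 hden
  refine ⟨(denom_ne_zero_iff (hconv t ht) Cp Cm).2 (hdet' t ht hdet), fun l => ?_⟩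
  set U : Set ℝ := {s | (krylov A (phi A Cp (Function.update t 0 s))
    (psi A Cm (Function.update t 0 s))).det ≠ 0} with hU
  have hUo : IsOpen U := isOpen_iff_mem_nhds.2 fun s hs =>
    eventually_det_krylov_ne_zero (Commute.refl A) (vecDeriv_phi_space ht Cp s)
      (vecDeriv_psi_space ht Cm s) hs
  have h0 : t 0 ∈ U := by
    rw [hU, Set.mem_ofPred_eq, Function.update_eq_self]
    exact hdet
  have key := evalLine_akns_krylov hUo (vecDeriv_phi_space ht Cp) (vecDeriv_psi_space ht Cm)
    (fun s hs => hs)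
    (w := fun i s => (![ratio n (phi A Cp) (psi A Cm),
      reducedR δ σ₁ σ₂ (ratio n (phi A Cp) (psi A Cm))] i) (Function.update t 0 s))
    (fun s _ => ratio_eq_qCoeff (ht.update 0 s) Cp Cm) (fun s hs => hr _ (ht.update 0 s) hs)
    (2 * l + 1) h0
  refine ⟨(key.1 0).contDiffAt (hUo.mem_nhds h0), (key.1 1).contDiffAt (hUo.mem_nhds h0), ?_⟩
  rw [DiffPoly.evalAt_eq_evalLine, key.2]
  have hl := hasDerivAt_qCoeff (vecDeriv_phi ht Cp l (t l)) (vecDeriv_psi ht Cm l (t l))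
    (by rw [Function.update_eq_self]; exact hdet)
  simp only [Function.update_eq_self] at hl ⊢
  -- The identity with `qCoeff` holds for every `s`, zeros of the denominator included, by the
  -- default values.
  refine hl.congr_of_eventuallyEq (Filter.Eventually.of_forall fun s => ?_)
  exact ratio_eq_qCoeff (ht.update l s) Cp Cm

end Solution

end CmKdV

namespace CmKdV
open Matrix

/-! ### Block diagonal A and diagonal K -/

section Blocks

variable {n : ℕ}

theorem blocks_mul (M₁ M₂ M₃ M₄ M₁' M₂' M₃' M₄' : Matrix (Fin (n + 1)) (Fin (n + 1)) ℂ) :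
    blocks M₁ M₂ M₃ M₄ * blocks M₁' M₂' M₃' M₄' =
      blocks (M₁ * M₁' + M₂ * M₃') (M₁ * M₂' + M₂ * M₄') (M₃ * M₁' + M₄ * M₃')
        (M₃ * M₂' + M₄ * M₄') := by
  simp only [blocks, reindex_apply, submatrix_mul_equiv, fromBlocks_multiply]

theorem blocks_add (M₁ M₂ M₃ M₄ M₁' M₂' M₃' M₄' : Matrix (Fin (n + 1)) (Fin (n + 1)) ℂ) :
    blocks M₁ M₂ M₃ M₄ + blocks M₁' M₂' M₃' M₄' =
      blocks (M₁ + M₁') (M₂ + M₂') (M₃ + M₃') (M₄ + M₄') := by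
  rw [blocks, blocks, blocks, ← fromBlocks_add]; rfl

theorem blocks_smul (c : ℂ) (M₁ M₂ M₃ M₄ : Matrix (Fin (n + 1)) (Fin (n + 1)) ℂ) :
    c • blocks M₁ M₂ M₃ M₄ = blocks (c • M₁) (c • M₂) (c • M₃) (c • M₄) := by
  rw [blocks, blocks, ← fromBlocks_smul]; rfl

theorem conjM_blocks (M₁ M₂ M₃ M₄ : Matrix (Fin (n + 1)) (Fin (n + 1)) ℂ) :
    conjM (blocks M₁ M₂ M₃ M₄) = blocks (conjM M₁) (conjM M₂) (conjM M₃) (conjM M₄) := by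
  rw [blocks, blocks]
  simp only [conjM]
  rw [← fromBlocks_map]; rfl

theorem blocks_zero : blocks (0 : Matrix (Fin (n + 1)) (Fin (n + 1)) ℂ) 0 0 0 = 0 := by
  simp [blocks]

theorem blocks_one : blocks (1 : Matrix (Fin (n + 1)) (Fin (n + 1)) ℂ) 0 0 1 = 1 := by
  simp [blocks]

theorem conjM_smul {κ μ : Type*} (c : ℂ) (M : Matrix κ μ ℂ) :
    conjM (c • M) = starRingEnd ℂ c • conjM M := by
  ext i j; simp [conjM]

theorem conjM_conjM {κ μ : Type*} (M : Matrix κ μ ℂ) : conjM (conjM M) = M := by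
  ext i j; simp [conjM]

theorem conjM_zero {κ μ : Type*} : conjM (0 : Matrix κ μ ℂ) = 0 := by
  ext i j; simp [conjM]

theorem conjM_one {κ : Type*} [DecidableEq κ] : conjM (1 : Matrix κ κ ℂ) = 1 := by
  ext i j; simp [conjM, Matrix.one_apply, apply_ite]

theorem tableA_mul_tableT {δ σ₁ : ℝ} (hσ₁ : σ₁ = 1 ∨ σ₁ = -1)
    (K : Matrix (Fin (n + 1)) (Fin (n + 1)) ℂ) :
    tableA σ₁ K * tableT n δ σ₁ + (σ₁ : ℂ) • (tableT n δ σ₁ * conjM (tableA σ₁ K)) = 0 := by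
  rw [tableA, tableT, conjM_blocks, blocks_mul, blocks_mul, blocks_smul, blocks_add, ← blocks_zero]
  simp only [conjM_smul, conjM_conjM, conjM_zero, Matrix.mul_zero, Matrix.zero_mul, zero_add,
    add_zero, Matrix.mul_one, Matrix.one_mul, Matrix.mul_smul, Matrix.smul_mul, smul_zero,
    map_neg, Complex.conj_ofReal, smul_smul]
  congr 1
  -- The upper right block needs σ₁² = 1; the lower left one cancels outright.
  · rcases hσ₁ with rfl | rfl <;> simp
  · simp

theorem tableT_mul_conjM {δ σ₁ : ℝ} : tableT n δ σ₁ * conjM (tableT n δ σ₁) =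
    ((δ * σ₁ : ℝ) : ℂ) • (1 : Matrix _ _ ℂ) := by
  rw [tableT, conjM_blocks, blocks_mul, ← blocks_one, blocks_smul]
  simp [conjM_smul, conjM_zero, conjM_one]

/-- The block diagonal embedding of pairs of matrices. -/
def blockHom (n : ℕ) :
    Matrix (Fin (n + 1)) (Fin (n + 1)) ℂ × Matrix (Fin (n + 1)) (Fin (n + 1)) ℂ →+*
      Matrix (Fin ((n + 1) + (n + 1))) (Fin ((n + 1) + (n + 1))) ℂ where
  toFun P := blocks P.1 0 0 P.2
  map_one' := blocks_one
  map_zero' := blocks_zero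
  map_mul' P Q := by rw [blocks_mul]; simp
  map_add' P Q := by rw [blocks_add]; simp

theorem blockHom_apply (M N : Matrix (Fin (n + 1)) (Fin (n + 1)) ℂ) :
    blockHom n (M, N) = blocks M 0 0 N := rfl

theorem blockHom_smul (c : ℂ) (P) : blockHom n (c • P) = c • blockHom n P := by
  change blocks _ _ _ _ = c • blocks _ _ _ _
  rw [blocks_smul]; simp

theorem continuous_blockHom : Continuous (blockHom n) :=
  (Continuous.matrix_fromBlocks continuous_fst continuous_const continuous_const
    continuous_snd).matrix_reindex _ _

theorem blockHom_mulVec_append (M N : Matrix (Fin (n + 1)) (Fin (n + 1)) ℂ)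
    (u v : Fin (n + 1) → ℂ) :
    blockHom n (M, N) *ᵥ Fin.append u v = Fin.append (M *ᵥ u) (N *ᵥ v) := by
  funext i
  rw [blockHom_apply, mulVec, dotProduct, Fin.sum_univ_add]
  refine Fin.addCases (fun i => ?_) (fun i => ?_) i
  · simp only [blocks, reindex_apply, submatrix_apply, finSumFinEquiv_symm_apply_castAdd,
      finSumFinEquiv_symm_apply_natAdd, fromBlocks_apply₁₁, fromBlocks_apply₁₂, Fin.append_left,
      Fin.append_right, Matrix.zero_apply, zero_mul, Finset.sum_const_zero, add_zero]
    rfl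
  · simp only [blocks, reindex_apply, submatrix_apply, finSumFinEquiv_symm_apply_castAdd,
      finSumFinEquiv_symm_apply_natAdd, fromBlocks_apply₂₁, fromBlocks_apply₂₂, Fin.append_left,
      Fin.append_right, Matrix.zero_apply, zero_mul, Finset.sum_const_zero, zero_add]
    rfl

section
attribute [local instance] Matrix.linftyOpNormedRing Matrix.linftyOpNormedAlgebra

theorem exp_blockHom (M N : Matrix (Fin (n + 1)) (Fin (n + 1)) ℂ) :
    NormedSpace.exp (blockHom n (M, N)) =
      blockHom n (NormedSpace.exp M, NormedSpace.exp N) := by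
  have h := ((NormedSpace.exp_series_hasSum_exp' (𝕂 := ℂ) M).prodMk
    (NormedSpace.exp_series_hasSum_exp' (𝕂 := ℂ) N)).map (blockHom n) continuous_blockHom
  have hterm : ∀ p : ℕ, blockHom n ((p.factorial : ℂ)⁻¹ • M ^ p, (p.factorial : ℂ)⁻¹ • N ^ p) =
      (p.factorial : ℂ)⁻¹ • blockHom n (M, N) ^ p := by
    intro p
    rw [← map_pow, ← blockHom_smul]; rfl
  simp only [Function.comp_def, hterm] at h
  rw [NormedSpace.exp_eq_tsum ℂ]
  exact h.tsum_eq

end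

/-- Both series are summed blockwise and carried over by the continuous ring homomorphism
`blockHom`, so convergence for `tableA` is a consequence. -/
theorem phi_tableA {σ : ℝ} {K M₁ M₂ : Matrix (Fin (n + 1)) (Fin (n + 1)) ℂ} {t : ℕ → ℝ}
    (h₁ : HasSum (fun j : ℕ => (t j : ℂ) • K ^ (2 * j + 1)) M₁)
    (h₂ : HasSum (fun j : ℕ => (t j : ℂ) • ((-σ : ℂ) • conjM K) ^ (2 * j + 1)) M₂)
    (u v : Fin (n + 1) → ℂ) : phi (tableA σ K) (Fin.append u v) t =
      Fin.append (NormedSpace.exp ((1 / 2 : ℂ) • M₁) *ᵥ u)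
        (NormedSpace.exp ((1 / 2 : ℂ) • M₂) *ᵥ v) := by
  have hA : tableA σ K = blockHom n (K, (-σ : ℂ) • conjM K) := rfl
  have h := (h₁.prodMk h₂).map (blockHom n) continuous_blockHom
  have hterm : ∀ j : ℕ, blockHom n ((t j : ℂ) • K ^ (2 * j + 1),
      (t j : ℂ) • ((-σ : ℂ) • conjM K) ^ (2 * j + 1)) = (t j : ℂ) • tableA σ K ^ (2 * j + 1) := by
    intro j
    rw [hA, ← map_pow, ← blockHom_smul]; rfl
  simp only [Function.comp_def, hterm] at h
  rw [phi, exponent, h.tsum_eq, ← blockHom_smul, Prod.smul_mk, exp_blockHom,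
    blockHom_mulVec_append]

theorem tableA_diagonal (σ : ℝ) (k : Fin (n + 1) → ℂ) : tableA σ (diagonal k) =
    diagonal (Fin.append k fun i => -(σ : ℂ) * starRingEnd ℂ (k i)) := by
  have hc : (-σ : ℂ) • conjM (diagonal k) = diagonal fun i => -(σ : ℂ) * starRingEnd ℂ (k i) := by
    ext i j
    by_cases h : i = j
    · subst h; simp [conjM]
    · simp [conjM, h]
  rw [tableA, hc, blocks]
  ext i j
  refine Fin.addCases (fun i => ?_) (fun i => ?_) i <;>
    refine Fin.addCases (fun j => ?_) (fun j => ?_) j <;>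
    simp only [reindex_apply, submatrix_apply, finSumFinEquiv_symm_apply_castAdd,
      finSumFinEquiv_symm_apply_natAdd, fromBlocks_apply₁₁, fromBlocks_apply₁₂,
      fromBlocks_apply₂₁, fromBlocks_apply₂₂, Matrix.zero_apply]
  · by_cases h : i = j
    · subst h; simp
    · rw [diagonal_apply_ne _ h, diagonal_apply_ne _ (by simpa [Fin.ext_iff] using h)]
  · rw [diagonal_apply_ne _ (by simp only [ne_eq, Fin.ext_iff, Fin.val_castAdd, Fin.val_natAdd]; omega)]
  · rw [diagonal_apply_ne _ (by simp only [ne_eq, Fin.ext_iff, Fin.val_castAdd, Fin.val_natAdd]; omega)]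
  · by_cases h : i = j
    · subst h; rw [diagonal_apply_eq, diagonal_apply_eq, Fin.append_right]
    · rw [diagonal_apply_ne _ h, diagonal_apply_ne _ (by simpa [Fin.ext_iff] using h)]

theorem phi_diagonal {N : ℕ} {κ : Fin N → ℂ} {t : ℕ → ℝ} (h : Converges (diagonal κ) t)
    (Cp : Fin N → ℂ) :
    phi (diagonal κ) Cp t = fun i => Complex.exp (xi (κ i) t) * Cp i := by
  have hterm : ∀ j : ℕ, (t j : ℂ) • diagonal κ ^ (2 * j + 1) =
      diagonal (fun i => κ i ^ (2 * j + 1) * (t j : ℂ)) := by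
    intro j
    rw [diagonal_pow, ← diagonal_smul]
    congr 1
    funext i
    simp [mul_comm]
  have hs : Summable fun (j : ℕ) (i : Fin N) => κ i ^ (2 * j + 1) * (t j : ℂ) := by
    rw [Converges] at h
    simp only [hterm] at h
    exact summable_matrix_diagonal.1 h
  have hX : exponent (diagonal κ) t = diagonal fun i => xi (κ i) t := by
    rw [exponent]
    simp only [hterm]
    rw [← diagonal_tsum, ← diagonal_smul]
    congr 1
    funext i
    rw [Pi.smul_apply, tsum_apply hs, xi, smul_eq_mul]
  funext i
  rw [phi, hX, exp_diagonal, mulVec_diagonal, Pi.coe_exp, Complex.exp_eq_exp_ℂ]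

end Blocks

/-! ### Jordan blocks acting on Taylor coefficients -/

section Taylor

variable {n : ℕ} {κ : ℂ}

/-- Weierstrass' theorem on derivatives of locally uniform limits, iterated. -/
theorem tendstoLocallyUniformlyOn_iteratedDeriv {ι : Type*} {l : Filter ι} {F : ι → ℂ → ℂ}
    {f : ℂ → ℂ} {U : Set ℂ} (hU : IsOpen U) (h : TendstoLocallyUniformlyOn F f l U)
    (hF : ∀ s, DifferentiableOn ℂ (F s) U) (i : ℕ) :
    TendstoLocallyUniformlyOn (fun s => iteratedDeriv i (F s)) (iteratedDeriv i f) l U ∧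
      ∀ s, DifferentiableOn ℂ (iteratedDeriv i (F s)) U := by
  induction i with
  | zero => simpa using ⟨h, hF⟩
  | succ i ih =>
    simp only [iteratedDeriv_succ]
    exact ⟨ih.1.deriv (Filter.Eventually.of_forall ih.2) hU, fun s => (ih.2 s).deriv hU⟩

theorem hasSum_taylorVec {g : ℕ → ℂ → ℂ} {U : Set ℂ} {u : ℕ → ℝ} (hU : IsOpen U) (hκ : κ ∈ U)
    (hg : ∀ j, DifferentiableOn ℂ (g j) U) (hu : Summable u)
    (hgu : ∀ j, ∀ z ∈ U, ‖g j z‖ ≤ u j) (n : ℕ) :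
    HasSum (fun j => taylorVec n (g j) κ) (taylorVec n (fun z => ∑' j, g j z) κ) := by
  have hF : ∀ s : Finset ℕ, DifferentiableOn ℂ (fun z => ∑ j ∈ s, g j z) U := fun s =>
    DifferentiableOn.fun_sum fun j _ => hg j
  refine Pi.hasSum.2 fun i => HasSum.div_const ?_ _
  have h := ((tendstoLocallyUniformlyOn_iteratedDeriv hU
    (tendstoUniformlyOn_tsum hu hgu).tendstoLocallyUniformlyOn hF i).1).tendsto_at hκ
  refine h.congr fun s => ?_
  exact iteratedDeriv_fun_sum fun j _ =>
    ((hg j).analyticAt (hU.mem_nhds hκ)).contDiffAt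

theorem taylorVec_const_mul (c : ℂ) (g : ℂ → ℂ) :
    taylorVec n (fun z => c * g z) κ = c • taylorVec n g κ := by
  funext i
  simp [taylorVec, iteratedDeriv_const_mul_field, mul_div_assoc]

theorem taylorVec_sub_pow (k : Fin (n + 1)) :
    taylorVec n (fun z => (z - κ) ^ (k : ℕ)) κ = Pi.single k 1 := by
  funext i
  have h := congrFun (iteratedDeriv_comp_sub_const (i : ℕ) (fun z : ℂ => z ^ (k : ℕ)) κ) κ
  rw [taylorVec, h, sub_self, iteratedDeriv_fun_pow_zero]
  by_cases hik : i = k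
  · subst hik
    simp [Nat.factorial_ne_zero]
  · rw [if_neg (fun h => hik (Fin.ext h)), Pi.single_eq_of_ne hik]
    simp

/-- The matrix `M` acts on Taylor coefficients at `κ` as multiplication by the function `g`. -/
def Represents (n : ℕ) (κ : ℂ) (M : Matrix (Fin (n + 1)) (Fin (n + 1)) ℂ) (g : ℂ → ℂ) : Prop :=
  ∀ h : ℂ → ℂ, AnalyticAt ℂ h κ → M *ᵥ taylorVec n h κ = taylorVec n (fun z => g z * h z) κ

theorem represents_jordan : Represents n κ (jordan n κ) fun z => z := by
  intro h hh
  -- Leibniz' formula stops after two terms because the factor `z` has vanishing second derivative.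
  -- Division by factorials turns this into a diagonal and a subdiagonal entry.
  have hd : ∀ m : ℕ, iteratedDeriv (m + 1) (fun z => z * h z) κ =
      κ * iteratedDeriv (m + 1) h κ + (m + 1) * iteratedDeriv m h κ := by
    intro m
    rw [iteratedDeriv_fun_mul contDiffAt_fun_id hh.contDiffAt, Finset.sum_range_succ',
      Finset.sum_range_succ', Finset.sum_eq_zero]
    · simp [iteratedDeriv_fun_id]; ring
    · intro j _
      simp [iteratedDeriv_fun_id]
  funext i
  have hJ : ∀ k : Fin (n + 1), jordan n κ i k =
      (if i = k then κ else 0) + if (i : ℕ) = (k : ℕ) + 1 then 1 else 0 := by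
    intro k
    rw [jordan, of_apply]
    by_cases hik : i = k
    · subst hik; simp
    · simp [hik]
  rw [mulVec, dotProduct]
  simp only [hJ, add_mul, ite_mul, zero_mul, one_mul, Finset.sum_add_distrib,
    Finset.sum_ite_eq, Finset.mem_univ, if_true]
  rcases i with ⟨i, hi⟩
  cases i with
  | zero => simp [taylorVec]
  | succ m =>
    rw [Finset.sum_eq_single ⟨m, by omega⟩]
    · simp only [if_true, taylorVec, hd, Nat.factorial_succ]
      have h1 : (m.factorial : ℂ) ≠ 0 := by exact_mod_cast m.factorial_ne_zero
      have h2 : (m + 1 : ℂ) ≠ 0 := by exact_mod_cast m.succ_ne_zero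
      push_cast
      field_simp
    · intro b _ hb
      rw [if_neg]
      intro hb'
      exact hb (Fin.ext (Nat.succ_injective hb').symm)
    · simp

theorem Represents.congr {M : Matrix (Fin (n + 1)) (Fin (n + 1)) ℂ} {g g' : ℂ → ℂ}
    (h : Represents n κ M g) (hg : ∀ z, g z = g' z) : Represents n κ M g' := by
  rwa [← funext hg]

theorem Represents.smul {M : Matrix (Fin (n + 1)) (Fin (n + 1)) ℂ} {g : ℂ → ℂ} (c : ℂ)
    (h : Represents n κ M g) : Represents n κ (c • M) fun z => c * g z := by
  intro f hf
  simp only [smul_mulVec, h f hf, mul_assoc, taylorVec_const_mul]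

theorem Represents.mul {M M' : Matrix (Fin (n + 1)) (Fin (n + 1)) ℂ} {g g' : ℂ → ℂ}
    (h : Represents n κ M g) (h' : Represents n κ M' g') (hg' : AnalyticAt ℂ g' κ) :
    Represents n κ (M * M') fun z => g z * g' z := by
  intro f hf
  simp only [← mulVec_mulVec, h' f hf, h _ (hg'.fun_mul hf), mul_assoc]

theorem Represents.pow {M : Matrix (Fin (n + 1)) (Fin (n + 1)) ℂ} {g : ℂ → ℂ}
    (h : Represents n κ M g) (hg : AnalyticAt ℂ g κ) (p : ℕ) :
    Represents n κ (M ^ p) fun z => g z ^ p := by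
  induction p with
  | zero => intro f _; simp
  | succ p ih => simpa only [pow_succ] using ih.mul h hg

theorem hasSum_mulVec {κ μ : Type*} [Fintype μ] {M : ℕ → Matrix κ μ ℂ} {S : Matrix κ μ ℂ}
    (h : HasSum M S) (v : μ → ℂ) : HasSum (fun j => M j *ᵥ v) (S *ᵥ v) :=
  Pi.hasSum.2 fun i => hasSum_sum fun k _ => (Pi.hasSum.1 (Pi.hasSum.1 h i) k).mul_right (v k)

theorem Represents.hasSum {M : ℕ → Matrix (Fin (n + 1)) (Fin (n + 1)) ℂ} {g : ℕ → ℂ → ℂ}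
    {U : Set ℂ} {u : ℕ → ℝ} (h : ∀ j, Represents n κ (M j) (g j)) (hU : IsOpen U) (hκ : κ ∈ U)
    (hg : ∀ j, DifferentiableOn ℂ (g j) U) (hu : Summable u)
    (hgu : ∀ j, ∀ z ∈ U, ‖g j z‖ ≤ u j) :
    ∃ S, HasSum M S ∧ Represents n κ S fun z => ∑' j, g j z := by
  have key : ∀ f : ℂ → ℂ, AnalyticAt ℂ f κ →
      HasSum (fun j => M j *ᵥ taylorVec n f κ) (taylorVec n (fun z => (∑' j, g j z) * f z) κ) := by
    intro f hf
    -- On a smaller neighbourhood `f` is bounded by `‖f κ‖ + 1`, so the products keep a summable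
    -- majorant.
    obtain ⟨V, hV, hVo, hκV⟩ := eventually_nhds_iff.1 ((hU.eventually_mem hκ).and
      (hf.eventually_analyticAt.and
        (hf.continuousAt.norm.eventually_lt_const (lt_add_one ‖f κ‖))))
    have := hasSum_taylorVec (g := fun j z => g j z * f z) hVo hκV
      (fun j z hz => ((hg j z (hV z hz).1).mono fun w hw => (hV w hw).1).mul
        (hV z hz).2.1.differentiableAt.differentiableWithinAt)
      (hu.mul_right (‖f κ‖ + 1)) (fun j z hz => by
        rw [norm_mul]
        exact mul_le_mul (hgu j z (hV z hz).1) (hV z hz).2.2.le (norm_nonneg _)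
          ((norm_nonneg _).trans (hgu j z (hV z hz).1))) n
    simpa only [h _ f hf, tsum_mul_right] using this
  -- The Taylor vectors of (z - κ)ᵏ are the standard basis, so convergence on Taylor vectors is
  -- convergence of each column.
  have hcol : ∀ k : Fin (n + 1), ∀ M : Matrix (Fin (n + 1)) (Fin (n + 1)) ℂ, ∀ i,
      (M *ᵥ taylorVec n (fun z => (z - κ) ^ (k : ℕ)) κ) i = M i k := by
    intro k M i
    rw [taylorVec_sub_pow]; simp
  have hS : HasSum M (Matrix.of fun i k =>
      taylorVec n (fun z => (∑' j, g j z) * (z - κ) ^ (k : ℕ)) κ i) := by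
    refine Pi.hasSum.2 fun i => Pi.hasSum.2 fun k => ?_
    have := Pi.hasSum.1 (key (fun z => (z - κ) ^ (k : ℕ)) (by fun_prop)) i
    simp only [hcol] at this
    exact this
  exact ⟨_, hS, fun f hf => (hasSum_mulVec hS _).unique (key f hf)⟩

theorem represents_exp {X : Matrix (Fin (n + 1)) (Fin (n + 1)) ℂ} {f : ℂ → ℂ}
    (h : Represents n κ X f) (hf : AnalyticAt ℂ f κ) :
    Represents n κ (NormedSpace.exp X) fun z => Complex.exp (f z) := by
  obtain ⟨V, hV, hVo, hκV⟩ := eventually_nhds_iff.1 (hf.eventually_analyticAt.and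
    (hf.continuousAt.norm.eventually_lt_const (lt_add_one ‖f κ‖)))
  obtain ⟨S, hS, hrep⟩ := Represents.hasSum
    (M := fun p => ((p.factorial : ℂ)⁻¹) • X ^ p) (g := fun p z => (p.factorial : ℂ)⁻¹ * f z ^ p)
    (u := fun p => (‖f κ‖ + 1) ^ p / p.factorial)
    (fun p => (h.pow hf p).smul _) hVo hκV
    (fun p z hz =>
      (((hV z hz).1.differentiableAt.pow p).const_mul _).differentiableWithinAt)
    (Real.summable_pow_div_factorial _)
    (fun p z hz => by
      rw [norm_mul, norm_inv, norm_pow, Complex.norm_natCast, div_eq_inv_mul]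
      have := (hV z hz).2.le
      gcongr)
  have hexp : NormedSpace.exp X = S := by
    rw [NormedSpace.exp_eq_tsum ℂ]
    exact hS.tsum_eq
  rw [hexp]
  refine hrep.congr fun z => ?_
  rw [Complex.exp_eq_exp_ℂ, NormedSpace.exp_eq_tsum ℂ]
  simp only [smul_eq_mul]

/-- The choices ε = 1 and ε = -σ₁ serve the two diagonal blocks. The radius R > |κ| provides a
uniform majorant on a disc around 0 containing κ. -/
theorem jordan_series {ε : ℂ} (hε : ‖ε‖ = 1) {t : ℕ → ℝ} {R : ℝ} (hκ : ‖κ‖ < R)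
    (hR : Summable fun j : ℕ => |t j| * R ^ (2 * j + 1)) :
    ∃ S, HasSum (fun j : ℕ => (t j : ℂ) • (ε • jordan n κ) ^ (2 * j + 1)) S ∧
      Represents n κ (NormedSpace.exp ((1 / 2 : ℂ) • S)) fun z => Complex.exp (xi (ε * z) t) := by
  have hκ' : κ ∈ Metric.ball (0 : ℂ) R := by simpa using hκ
  have hlin : AnalyticAt ℂ (fun z : ℂ => ε * z) κ := by fun_prop
  have hd : ∀ j : ℕ, DifferentiableOn ℂ (fun z : ℂ => (t j : ℂ) * (ε * z) ^ (2 * j + 1))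
      (Metric.ball 0 R) := fun j => by fun_prop
  have hb : ∀ j : ℕ, ∀ z ∈ Metric.ball (0 : ℂ) R,
      ‖(t j : ℂ) * (ε * z) ^ (2 * j + 1)‖ ≤ |t j| * R ^ (2 * j + 1) := by
    intro j z hz
    have hz' : ‖z‖ ≤ R := by simpa using (mem_ball_zero_iff.1 hz).le
    rw [norm_mul, norm_pow, norm_mul, hε, one_mul, Complex.norm_real, Real.norm_eq_abs]
    gcongr
  obtain ⟨S, hS, hrep⟩ := Represents.hasSum
    (fun j : ℕ => ((represents_jordan.smul ε).pow hlin (2 * j + 1)).smul (t j : ℂ))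
    Metric.isOpen_ball hκ' hd hR hb
  refine ⟨S, hS, represents_exp ((hrep.smul (1 / 2)).congr fun z => ?_) ?_⟩
  · simp only [xi, mul_comm]
  · have h1 := (Complex.differentiableOn_tsum_of_summable_norm hR hd Metric.isOpen_ball
      hb).analyticAt (Metric.isOpen_ball.mem_nhds hκ')
    have h2 := (analyticAt_const (v := (1 / 2 : ℂ))).fun_mul h1
    simpa only [xi, mul_comm] using h2

theorem conjM_jordan (k : ℂ) : conjM (jordan n k) = jordan n (starRingEnd ℂ k) := by
  ext i j
  simp only [conjM, jordan, map_apply, of_apply]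
  split_ifs <;> simp

end Taylor

end CmKdV

end

theorem theorem5 (n : ℕ) (δ σ₁ σ₂ : ℝ) (hδ : δ = 1 ∨ δ = -1) (hσ₁ : σ₁ = 1 ∨ σ₁ = -1)
    (hσ₂ : σ₂ = 1 ∨ σ₂ = -1) (hσ : σ₁ * σ₂ = 1) :
    -- the double Wronskian solutions
    (∀ (A T : Matrix (Fin ((n + 1) + (n + 1))) (Fin ((n + 1) + (n + 1))) ℂ)
        (Cp Cm : Fin ((n + 1) + (n + 1)) → ℂ),
      A * T + (σ₁ : ℂ) • (T * CmKdV.conjM A) = 0 →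
      T * CmKdV.conjM T = ((δ * σ₁ : ℝ) : ℂ) • (1 : Matrix _ _ ℂ) →
      Cm = Matrix.mulVec T (CmKdV.conjV Cp) →
      ∀ t : ℕ → ℝ, CmKdV.Converges A t →
        CmKdV.psi A Cm t =
          Matrix.mulVec T (CmKdV.conjV (CmKdV.phi A Cp (CmKdV.reflect σ₁ σ₂ t))) ∧
        (CmKdV.denom n (CmKdV.phi A Cp) (CmKdV.psi A Cm) t ≠ 0 →
          CmKdV.denom n (CmKdV.phi A Cp) (CmKdV.psi A Cm) (CmKdV.reflect σ₁ σ₂ t) ≠ 0 ∧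
          ∀ l : ℕ, CmKdV.SolvesAt δ σ₁ σ₂
            (CmKdV.ratio n (CmKdV.phi A Cp) (CmKdV.psi A Cm)) l t)) ∧
    -- the table of explicit `T` and `A`
    (∀ K : Matrix (Fin (n + 1)) (Fin (n + 1)) ℂ,
      CmKdV.tableA σ₁ K * CmKdV.tableT n δ σ₁ +
          (σ₁ : ℂ) • (CmKdV.tableT n δ σ₁ * CmKdV.conjM (CmKdV.tableA σ₁ K)) = 0 ∧
        CmKdV.tableT n δ σ₁ * CmKdV.conjM (CmKdV.tableT n δ σ₁) =
          ((δ * σ₁ : ℝ) : ℂ) • (1 : Matrix _ _ ℂ)) ∧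
    -- the vector `φ` when `K` is diagonal
    (∀ (k c d : Fin (n + 1) → ℂ) (t : ℕ → ℝ),
      CmKdV.Converges (CmKdV.tableA σ₁ (Matrix.diagonal k)) t →
      CmKdV.phi (CmKdV.tableA σ₁ (Matrix.diagonal k)) (Fin.append c d) t =
        Fin.append (fun i => c i * Complex.exp (CmKdV.xi (k i) t))
          (fun i => d i * Complex.exp (CmKdV.xi (-(σ₁ : ℂ) * starRingEnd ℂ (k i)) t))) ∧
    -- the vector `φ` when `K` is a Jordan block
    (∀ (k : ℂ) (c d : ℂ → ℂ), AnalyticAt ℂ c k → AnalyticAt ℂ d (starRingEnd ℂ k) →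
      ∀ (t : ℕ → ℝ) (R : ℝ), ‖k‖ < R → (Summable fun j : ℕ => |t j| * R ^ (2 * j + 1)) →
        CmKdV.phi (CmKdV.tableA σ₁ (CmKdV.jordan n k))
            (Fin.append (CmKdV.taylorVec n c k) (CmKdV.taylorVec n d (starRingEnd ℂ k))) t =
          Fin.append
            (CmKdV.taylorVec n (fun z => c z * Complex.exp (CmKdV.xi z t)) k)
            (CmKdV.taylorVec n
              (fun z => d z * Complex.exp (CmKdV.xi (-(σ₁ : ℂ) * z) t)) (starRingEnd ℂ k))) := by
  have hσ12 : σ₂ = σ₁ := by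
    rcases hσ₁ with rfl | rfl <;> rcases hσ₂ with rfl | rfl <;> first | rfl | norm_num at hσ
  have hc : δ * σ₁ ≠ 0 := by
    rcases hδ with rfl | rfl <;> rcases hσ₁ with rfl | rfl <;> norm_num
  refine ⟨?_, fun K => ⟨CmKdV.tableA_mul_tableT hσ₁ K, CmKdV.tableT_mul_conjM⟩, ?_, ?_⟩
  · intro A T Cp Cm hAT hT hCm t ht
    subst hCm
    refine ⟨?_, CmKdV.solvesAt_ratio hδ hσ₁ hσ12 hAT hT Cp ht⟩
    rw [CmKdV.reflect_eq hσ12]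
    exact CmKdV.psi_eq hσ₁ hc hAT hT ht Cp
  · intro k c d t ht
    rw [CmKdV.tableA_diagonal] at ht ⊢
    rw [CmKdV.phi_diagonal ht]
    funext i
    refine Fin.addCases (fun i => ?_) (fun i => ?_) i
    · simp only [Fin.append_left, mul_comm]
    · simp only [Fin.append_right, mul_comm (Complex.exp _)]
  · intro k c d hc hd t R hk hR
    obtain ⟨S₁, hS₁, hrep₁⟩ := CmKdV.jordan_series (n := n) (ε := 1) (by simp) hk hR
    obtain ⟨S₂, hS₂, hrep₂⟩ := CmKdV.jordan_series (n := n) (κ := starRingEnd ℂ k)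
      (ε := -(σ₁ : ℂ)) (by rcases hσ₁ with rfl | rfl <;> simp) (by simpa using hk) hR
    simp only [one_smul] at hS₁
    -- The conjugate of the Jordan block is the Jordan block of k*, whence Taylor coefficients at k*
    -- in the second half.
    rw [← CmKdV.conjM_jordan] at hS₂
    rw [CmKdV.phi_tableA hS₁ hS₂, hrep₁ c hc, hrep₂ d hd]
    simp only [one_mul, mul_comm (Complex.exp _)]
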